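/- Let $\gamma\ge 0$, $t\ge 0$, $\rho_a,\rho_b\in[0,1]$. For a set $S\subseteq\mathbb Z$ of sites consider spinless fermions with annihilation, creation and number operators $a_x,a_x^\dagger,n_x=a_x^\dagger a_x$ $(x\in S)$, and the Liouvillian $$\mathcal L[\rho]=-i[H,\rho]+\sum_{x\in S}\Big(L_x\rho L_x^\dagger-\tfrac12\{L_x^\dagger L_x,\rho\}\Big),\qquad H=-\sum_{x,\,x+1\in S}\big(a_x^\dagger a_{x+1}+a_{x+1}^\dagger a_x\big),\qquad L_x=\sqrt{4\gamma}\,n_x ,$$ with $e^{\mathcal Lt}=\sum_k t^k\mathcal L^k/k!$ applied to matrix elements in the occupation basis. Put $$q_n^S(t)=\sum_{y_1<\dots<y_n\le 0<x_1<\dots<x_n}\langle \mathbf x|\,e^{\mathcal Lt}\big[|\mathbf y\rangle\langle\mathbf y|\big]\,|\mathbf x\rangle ,\qquad |\mathbf x\rangle=a_{x_1}^\dagger\cdots a_{x_n}^\dagger|0\rangle ,$$ where all $x_j,y_j\in S$; write $q_n=q_n^{\mathbb Z}$ for the infinite chain and $q_n^{L}=q_n^{\Lambda_L}$ for the finite lattice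 $\Lambda_L=\{x\in\mathbb Z:-L<x\le L\}$ with open boundary conditions. On $\Lambda_L$ start from $\rho_{\rm ini}=\prod_x[\rho_xn_x+(1-\rho_x)(1-n_x)]$ with $\rho_x=\rho_a$ for $x\le0$ and $\rho_x=\rho_b$ for $x>0$, and let $Q_t$ be the integrated current through the bond $(0,1)$, that is, the difference of the outcomes of measurements of $N_R=\sum_{x\ge1}n_x$ at times $t$ and $0$: $$\Pr\nolimits_L[Q_t=n]=\sum_{m\ge0}\mathrm{Tr}\big[P_{m+n}\,e^{\mathcal Lt}[P_m\rho_{\rm ini}P_m]\big],\qquad \langle e^{\lambda Q_t}\rangle_L=\sum_{n\in\mathbb Z}e^{\lambda n}\Pr\nolimits_L[Q_t=n],$$ where $P_m$ is the projection onto the eigenspace $N_R=m$ ($P_m=0$ if there is none). The law of $Q_t$ on the infinite chain is the limit of these laws as $L\to\infty$. Finally let $$\omega=\rho_a(e^\lambda-1)+\rho_b(e^{-\lambda}-1)+\rho_a\rho_b(e^\lambda-1)(e^{-\lambda}-1).$$ Then the following hold. 1. For the infinite chain, the exponential series defining $\langle X|e^{\mathcal Lt}[|Y\rangle\langle Y|]|Z\rangle$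 converges absolutely for all finite configurations $X,Y,Z$, and the sum defining $q_n(t)$ converges absolutely for every $n\ge0$. 2. For every $L\ge 0$ and every $\lambda\in\mathbb C$, $\ \langle e^{\lambda Q_t}\rangle_L=\sum_{n=0}^{L}q_n^{L}(t)\,\omega^n$. 3. The limit law exists: there is a probability measure on $\mathbb Z$ such that $\Pr_L[Q_t=n]\to\Pr[Q_t=n]$ as $L\to\infty$ for every $n\in\mathbb Z$. For every $\lambda\in\mathbb C$, $e^{\lambda Q_t}$ is integrable under this law, $\langle e^{\lambda Q_t}\rangle_L\to\langle e^{\lambda Q_t}\rangle$, and $$\langle e^{\lambda Q_t}\rangle=\sum_{n\ge0}q_n(t)\,\omega^n ,$$ where the series converges. In particular $\langle e^{\lambda Q_t}\rangle$ depends on $\rho_a,\rho_b,\lambda$ only through $\omega$, since the $q_n(t)$ depend on none of them. 4. Under the limit law $Q_t$ has finite variance, and $$\sigma^2_{Q_t}=(\rho_a-\rho_b)^2\big(2q_2(t)-q_1(t)^2\big)+(\rho_a+\rho_b-2\rho_a\rho_b)\,q_1(t).$$ -/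

import Mathlib

open scoped Matrix

noncomputable section

namespace DephasingChain

/-- Operators on the fermionic Fock space over a set `S ⊆ ℤ` of sites, given by their matrix elements
`A X Y = ⟨X|A|Y⟩` in the orthonormal occupation basis `|X⟩ = a†_{x₁} ⋯ a†_{xₙ} |0⟩`, where
`X = {x₁ < ⋯ < xₙ}` runs over the finite subsets of `S`. -/
abbrev Op (S : Set ℤ) := Matrix (Finset S) (Finset S) ℂ

variable {S : Set ℤ}

/-- Operator product. For finite `S` it is matrix multiplication. For infinite `S` it is used below only
when one factor has finitely many nonzero entries in each row and each column, so that every sum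
is finite. -/
def opMul (A B : Op S) : Op S := fun X Y => ∑ᶠ Z, A X Z * B Z Y

/-- The creation operator `a†_x`: `a†_x |Y⟩ = (-1)^{#{y ∈ Y : y < x}} |Y ∪ {x}⟩` if `x ∉ Y`, and `0` if
`x ∈ Y`. -/
def create (x : S) : Op S := fun X Y =>
  if x ∉ Y ∧ X = insert x Y then (-1) ^ (Y.filter (fun y => y < x)).card else 0

/-- The annihilation operator `a_x`, the adjoint of `a†_x`. -/
def annih (x : S) : Op S := (create x)ᴴ

/-- The number operator `n_x = a†_x a_x`. -/
def num (x : S) : Op S := opMul (create x) (annih x)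

/-- The tight-binding Hamiltonian `H = -∑_x (a†_x a_{x+1} + a†_{x+1} a_x)`, the sum being over all bonds
`(x, x+1)` inside `S` (open boundary conditions). Each matrix element is a finite sum. -/
def hamiltonian (S : Set ℤ) : Op S := fun X Y =>
  -∑ᶠ b : {b : S × S // (b.2 : ℤ) = b.1 + 1},
    (opMul (create b.1.1) (annih b.1.2) + opMul (create b.1.2) (annih b.1.1)) X Y

/-- The Lindblad operator `L_x = √(4γ) n_x`. -/
def lindbladOp (γ : ℝ) (x : S) : Op S := ((Real.sqrt (4 * γ) : ℝ) : ℂ) • num x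

/-- The dissipator `L_x ρ L_x† - (L_x† L_x ρ + ρ L_x† L_x) / 2` at site `x`. -/
def dissipator (γ : ℝ) (x : S) (ρ : Op S) : Op S :=
  opMul (opMul (lindbladOp γ x) ρ) (lindbladOp γ x)ᴴ
    - (1 / 2 : ℂ) • (opMul (opMul (lindbladOp γ x)ᴴ (lindbladOp γ x)) ρ
      + opMul ρ (opMul (lindbladOp γ x)ᴴ (lindbladOp γ x)))

/-- The Liouvillian `𝓛[ρ] = -i [H, ρ] + ∑_x (L_x ρ L_x† - {L_x† L_x, ρ} / 2)`. In the matrix element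
between `X` and `Y` only the sites `x ∈ X ∪ Y` contribute to the sum. -/
def liouvillian (γ : ℝ) (ρ : Op S) : Op S := fun X Y =>
  -Complex.I * (opMul (hamiltonian S) ρ - opMul ρ (hamiltonian S)) X Y
    + ∑ᶠ x : S, dissipator γ x ρ X Y

/-- The terms `t^k / k! ⟨X| 𝓛^k[ρ] |Y⟩` of the exponential series. -/
def evolveTerm (γ t : ℝ) (ρ : Op S) (X Y : Finset S) (k : ℕ) : ℂ :=
  ((t : ℂ) ^ k / (k.factorial : ℂ)) * ((liouvillian γ)^[k] ρ) X Y

/-- The time evolution `e^{𝓛 t}[ρ] = ∑_k t^k / k! 𝓛^k[ρ]`. -/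
def evolve (γ t : ℝ) (ρ : Op S) : Op S := fun X Y => ∑' k : ℕ, evolveTerm γ t ρ X Y k

/-- The projection `|Y⟩⟨Y|`. -/
def ketBra (Y : Finset S) : Op S := Matrix.single Y Y 1

/-- Pairs `(Y, X)` of `n`-particle configurations with `Y ⊆ {y ≤ 0}` and `X ⊆ {x > 0}`. -/
def CrossingPair (S : Set ℤ) (n : ℕ) : Type :=
  {p : Finset S × Finset S // p.1.card = n ∧ p.2.card = n ∧
    (∀ y ∈ p.1, (y : ℤ) ≤ 0) ∧ (∀ x ∈ p.2, 0 < (x : ℤ))}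

/-- The `n`-particle density matrix element `⟨X| e^{𝓛 t}[|Y⟩⟨Y|] |X⟩` of a pair `(Y, X)`. -/
def crossingTerm (S : Set ℤ) (γ t : ℝ) (n : ℕ) (p : CrossingPair S n) : ℂ :=
  evolve γ t (ketBra p.1.1) p.1.2 p.1.2

/-- The coefficient `q_n(t)` on the lattice `S`: the sum over `y₁ < ⋯ < yₙ ≤ 0 < x₁ < ⋯ < xₙ` of
`⟨x| e^{𝓛 t}[|y⟩⟨y|] |x⟩`. -/
def q (S : Set ℤ) (γ t : ℝ) (n : ℕ) : ℂ := ∑' p : CrossingPair S n, crossingTerm S γ t n p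

/-- The finite lattice `Λ_L = {x ∈ ℤ : -L < x ≤ L}`. -/
abbrev box (L : ℕ) : Set ℤ := Set.Ioc (-(L : ℤ)) (L : ℤ)

/-- The density profile: `ρ_x = ρ_a` for `x ≤ 0` and `ρ_x = ρ_b` for `x > 0`. -/
def density (ρa ρb : ℝ) (x : ℤ) : ℝ := if x ≤ 0 then ρa else ρb

/-- The step initial state `∏_x [ρ_x n_x + (1 - ρ_x)(1 - n_x)]` on `Λ_L`, which is diagonal in the
occupation basis. -/
def initialState (L : ℕ) (ρa ρb : ℝ) : Op (box L) :=
  Matrix.diagonal fun X =>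
    ∏ x : box L, if x ∈ X then (density ρa ρb x : ℂ) else 1 - (density ρa ρb x : ℂ)

/-- The projection `P_m` onto the eigenspace of `N_R = ∑_{x ≥ 1} n_x` with eigenvalue `m` (zero if `m`
is not an eigenvalue). -/
def projRight (L : ℕ) (m : ℤ) : Op (box L) :=
  Matrix.diagonal fun X : Finset (box L) => if ((X.filter (fun x : box L => 0 < (x : ℤ))).card : ℤ) = m then 1 else 0

/-- The probability `Pr[Q_t = n] = ∑_{m ≥ 0} Tr[P_{m+n} e^{𝓛 t}[P_m ρ_ini P_m]]` on `Λ_L` that the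
outcomes of the measurements of `N_R` at times `t` and `0` differ by `n`. -/
def probCurrent (L : ℕ) (γ ρa ρb t : ℝ) (n : ℤ) : ℂ :=
  ∑' m : ℕ, (projRight L (m + n) *
    evolve γ t (projRight L m * initialState L ρa ρb * projRight L m)).trace

/-- The moment generating function `⟨e^{z Q_t}⟩ = ∑_{n ∈ ℤ} e^{z n} Pr[Q_t = n]` on `Λ_L`. -/
def mgfCurrent (L : ℕ) (γ ρa ρb t : ℝ) (z : ℂ) : ℂ :=
  ∑' n : ℤ, Complex.exp (z * n) * probCurrent L γ ρa ρb t n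

/-- `ω = ρ_a (e^z - 1) + ρ_b (e^{-z} - 1) + ρ_a ρ_b (e^z - 1)(e^{-z} - 1)`. -/
def omega (ρa ρb : ℝ) (z : ℂ) : ℂ :=
  ρa * (Complex.exp z - 1) + ρb * (Complex.exp (-z) - 1)
    + ρa * ρb * (Complex.exp z - 1) * (Complex.exp (-z) - 1)

/-- `μ` is the law of the integrated current `Q_t` of the infinite chain: the limit `L → ∞` of the laws
of `Q_t` on the finite lattices `Λ_L`. -/
def IsCurrentLaw (γ ρa ρb t : ℝ) (μ : MeasureTheory.Measure ℤ) : Prop :=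
  MeasureTheory.IsProbabilityMeasure μ ∧
    ∀ n : ℤ, Filter.Tendsto (fun L : ℕ => probCurrent L γ ρa ρb t n) Filter.atTop
      (nhds ((μ.real {n} : ℝ) : ℂ))

end DephasingChain

end

/-!
The full counting statistics of the dephasing chain depend on the two densities and the counting
field only through `ω` because the Liouvillian commutes with the two superoperators
`ρ ↦ ∑_x a_x ρ a†_x` and `ρ ↦ ∑_x a†_x ρ a_x` (`liouvillian_lowering`, `liouvillian_raising`): the
hopping is quadratic, and dephasing only sees the sites at which two configurations differ. On a
finite lattice the weights `T(X, Y) = ⟨X| e^{𝓛 t}[|Y⟩⟨Y|] |X⟩` therefore satisfy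
`∑_{x ∉ X} T(X ∪ {x}, Y) = ∑_{y ∈ Y} T(X, Y \ {y})` and the mirror identity
(`sum_transition_insert`, `sum_transition_erase`). Iterating, and using that `T` conserves the number
of particles, `∑_{X' ⊇ X} T(X', Y) = ∑_{Y' ⊆ Y} T(X, Y')` (`sum_superset_eq_sum_powerset`), and likewise
with the two arguments exchanged.

The initial state is a product measure and the counting factor a product over sites. The first
duality moves the final configuration to the right half, the second one the initial configuration
to the left half. What remains is the sum over pairs of equally many particles that all cross the
bond, with a factor `ω` for each (`sum_prod_eq`). This is the formula for finite lattices
(`mgfCurrent_eq_sum_q`).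

In the occupation basis a hop between neighbouring sites carries no fermionic sign, so the
Liouvillian acts on functions of two finite sets of integers by a formula that makes sense for every
lattice `S ⊆ ℤ` (`siteLiouvillian`). In the weight `∏_{x ∈ X} 2^{-x}` it is bounded by a constant times
the number of particles (`norm_siteLiouvillian_le`). Hence the exponential series converges, the
coefficients `q_n` decay faster than any exponential uniformly in the lattice (`exists_norm_q_le`), and
dominated convergence carries them from the boxes to the infinite chain (`tendsto_q`), together with
the series in `ω` (`tendsto_sum_q_mul_pow`).

The weights `T` are nonnegative, the semigroup being a limit of powers of completely positive maps
(`act_evolveCLM_diag_nonneg`), so the currents have genuine laws on finite lattices. Their moment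
generating functions converge on all of `ℂ`. Fourier inversion gives the convergence of the laws, and
the exponential moments give tails that identify the limit of the generating functions with the
generating function of the limit (`exists_limit_law`). Differentiating `∑ q_n ω^n` twice at the origin,
where `ω = 0`, gives the variance (`variance_of_integral_exp_eq`).
-/

namespace DephasingChain
noncomputable section

/-! ### Canonical anticommutation relations -/

section Fock
variable {S : Set ℤ}

/-- The Jordan–Wigner sign `(-1)^{#{y ∈ Y : y < x}}`. -/
def jwSign (Y : Finset S) (x : S) : ℂ := (-1) ^ (Y.filter (fun y => y < x)).card

lemma jwSign_insert {Y : Finset S} {x y : S} (hy : y ∉ Y) :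
    jwSign (insert y Y) x = (if y < x then -1 else 1) * jwSign Y x := by
  unfold jwSign
  rw [Finset.filter_insert]
  split_ifs with h
  · rw [Finset.card_insert_of_notMem (by simp [hy]), pow_succ]; ring
  · simp

lemma jwSign_mul_self (Y : Finset S) (x : S) : jwSign Y x * jwSign Y x = 1 := by
  unfold jwSign
  rw [← mul_pow]; simp

lemma star_jwSign (Y : Finset S) (x : S) : star (jwSign Y x) = jwSign Y x := by
  simp [jwSign]

lemma create_apply (x : S) (X Y : Finset S) :
    create x X Y = if x ∉ Y ∧ X = insert x Y then jwSign Y x else 0 := rfl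

lemma create_apply' (x : S) (X Y : Finset S) :
    create x X Y = if x ∈ X ∧ Y = X.erase x then jwSign Y x else 0 := by
  rw [create_apply]
  congr 1
  apply propext
  constructor
  · rintro ⟨h, rfl⟩
    simp [h]
  · rintro ⟨h, rfl⟩
    simp [h]

lemma annih_apply (x : S) (X Y : Finset S) :
    annih x X Y = if x ∉ X ∧ Y = insert x X then jwSign X x else 0 := by
  rw [annih, Matrix.conjTranspose_apply, create_apply]
  split_ifs <;> simp [star_jwSign]

lemma annih_apply' (x : S) (X Y : Finset S) :
    annih x X Y = if x ∈ Y ∧ X = Y.erase x then jwSign X x else 0 := by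
  rw [annih, Matrix.conjTranspose_apply, create_apply']
  split_ifs <;> simp [star_jwSign]

lemma conjTranspose_annih (x : S) : (annih x)ᴴ = create x := by
  rw [annih, Matrix.conjTranspose_conjTranspose]

section Finite
variable [Fintype S]

lemma opMul_eq_mul (A B : Op S) : opMul A B = A * B := by
  ext X Y
  rw [opMul, finsum_eq_sum_of_fintype, Matrix.mul_apply]

lemma create_mul_apply (x : S) (A : Op S) (X Y : Finset S) :
    (create x * A) X Y = if x ∈ X then jwSign (X.erase x) x * A (X.erase x) Y else 0 := by
  rw [Matrix.mul_apply]
  simp_rw [create_apply']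
  by_cases h : x ∈ X <;> simp [h]

lemma annih_mul_apply (x : S) (A : Op S) (X Y : Finset S) :
    (annih x * A) X Y = if x ∉ X then jwSign X x * A (insert x X) Y else 0 := by
  rw [Matrix.mul_apply]
  simp_rw [annih_apply]
  by_cases h : x ∈ X <;> simp [h]

lemma mul_create_apply (x : S) (A : Op S) (X Y : Finset S) :
    (A * create x) X Y = if x ∉ Y then jwSign Y x * A X (insert x Y) else 0 := by
  rw [Matrix.mul_apply]
  simp_rw [create_apply]
  by_cases h : x ∈ Y <;> simp [h, mul_comm]

lemma mul_annih_apply (x : S) (A : Op S) (X Y : Finset S) :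
    (A * annih x) X Y = if x ∈ Y then jwSign (Y.erase x) x * A X (Y.erase x) else 0 := by
  rw [Matrix.mul_apply]
  simp_rw [annih_apply']
  by_cases h : x ∈ Y <;> simp [h, mul_comm]

lemma annih_mul_annih (x y : S) : annih x * annih y = -(annih y * annih x) := by
  ext X Y
  rw [Matrix.neg_apply, annih_mul_apply, annih_mul_apply]
  simp_rw [annih_apply]
  rcases eq_or_ne x y with rfl | hxy
  · by_cases hx : x ∈ X <;> simp [hx]
  by_cases hx : x ∈ X
  · simp [hx]
  by_cases hy : y ∈ X
  · simp [hy]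
  simp only [hx, hy, Finset.mem_insert, hxy, hxy.symm, or_self, not_false_eq_true, true_and,
    if_true, jwSign_insert hx, jwSign_insert hy, Finset.insert_comm y x X]
  split_ifs with h1 h2 h3 h3
  · exact absurd h2 (not_lt.2 h3.le)
  · ring
  · ring
  · exact absurd (le_antisymm (not_lt.1 h3) (not_lt.1 h2)) (by simpa using hxy)
  · simp

lemma create_mul_create (x y : S) : create x * create y = -(create y * create x) := by
  have h := congrArg Matrix.conjTranspose (annih_mul_annih y x)
  simpa [Matrix.conjTranspose_mul, conjTranspose_annih] using h

lemma annih_mul_create_of_ne {x y : S} (hxy : x ≠ y) :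
    annih x * create y = -(create y * annih x) := by
  ext X Y
  rw [Matrix.neg_apply, annih_mul_apply, create_mul_apply]
  simp_rw [create_apply', annih_apply]
  by_cases hx : x ∈ X
  · simp [hx, hxy]
  by_cases hy : y ∈ X
  · have hx' : x ∉ X.erase y := by simp [hx]
    have e : (insert x X).erase y = insert x (X.erase y) := Finset.erase_insert_of_ne hxy
    simp only [hx, hy, e, not_false_eq_true, if_true, Finset.mem_insert, hxy.symm, or_true,
      true_and, hx']
    by_cases hY : Y = insert x (X.erase y)
    · subst hY
      simp only [if_true]
      rw [jwSign_insert hx']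
      have e2 : jwSign X x = (if y < x then -1 else 1) * jwSign (X.erase y) x := by
        rw [← jwSign_insert (Finset.notMem_erase y X), Finset.insert_erase hy]
      rw [e2]
      split_ifs with h1 h2 h2
      · exact absurd h2 (not_lt.2 h1.le)
      · ring
      · ring
      · exact absurd (le_antisymm (not_lt.1 h1) (not_lt.1 h2)) hxy
    · simp [hY]
  · simp [hx, hy, hxy.symm]

lemma annih_mul_create_self (x : S) : annih x * create x = 1 - create x * annih x := by
  ext X Y
  rw [Matrix.sub_apply, annih_mul_apply, create_mul_apply]
  simp_rw [create_apply', annih_apply', Matrix.one_apply]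
  by_cases hx : x ∈ X
  · simp only [hx, not_true_eq_false, if_false, if_true]
    by_cases h : X = Y
    · subst h; simp [hx, jwSign_mul_self]
    · have : ¬ (x ∈ Y ∧ X.erase x = Y.erase x) := by
        rintro ⟨h1, h2⟩
        exact h (by rw [← Finset.insert_erase hx, h2, Finset.insert_erase h1])
      simp [h, this]
  · by_cases h : X = Y
    · subst h; simp [hx, jwSign_mul_self]
    · have : Y ≠ X := fun e => h e.symm
      simp [hx, h, this]

lemma annih_mul_create (x y : S) :
    annih x * create y = (if x = y then 1 else 0) - create y * annih x := by
  split_ifs with h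
  · subst h; exact annih_mul_create_self x
  · rw [annih_mul_create_of_ne h, zero_sub]

/-- `[a†_c a_d, a_x] = -δ_{cx} a_d`. -/
lemma hop_mul_annih (c d x : S) :
    create c * annih d * annih x
      = annih x * (create c * annih d) - (if x = c then annih d else 0) := by
  rw [mul_assoc, annih_mul_annih d x, mul_neg, ← mul_assoc, ← mul_assoc, annih_mul_create x c,
    sub_mul]
  split_ifs <;> simp

/-- `[a†_c a_d, a†_x] = δ_{dx} a†_c`. -/
lemma hop_mul_create (c d x : S) :
    create c * annih d * create x
      = create x * (create c * annih d) + (if d = x then create c else 0) := by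
  rw [mul_assoc, annih_mul_create d x, mul_sub, ← mul_assoc, create_mul_create c x, neg_mul,
    mul_assoc]
  split_ifs <;> simp [add_comm]

end Finite

/-! ### Dephasing -/

lemma num_eq_diagonal (x : S) : num x = Matrix.diagonal fun X => if x ∈ X then 1 else 0 := by
  ext X Y
  rw [num, opMul, finsum_eq_single _ (X.erase x)]
  · rw [create_apply', annih_apply', Matrix.diagonal_apply]
    by_cases hx : x ∈ X
    · by_cases h : X = Y
      · subst h; simp [hx, jwSign_mul_self]
      · have : ¬ (x ∈ Y ∧ X.erase x = Y.erase x) := by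
          rintro ⟨h1, h2⟩
          exact h (by rw [← Finset.insert_erase hx, h2, Finset.insert_erase h1])
        simp [h, this]
    · simp [hx]
  · intro Z hZ
    rw [create_apply', if_neg (fun h => hZ h.2), zero_mul]

lemma opMul_diagonal (A : Op S) (d : Finset S → ℂ) (X Y : Finset S) :
    opMul A (Matrix.diagonal d) X Y = A X Y * d Y := by
  rw [opMul, finsum_eq_single _ Y]
  · simp
  · intro Z hZ
    simp [hZ]

lemma diagonal_opMul (A : Op S) (d : Finset S → ℂ) (X Y : Finset S) :
    opMul (Matrix.diagonal d) A X Y = d X * A X Y := by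
  rw [opMul, finsum_eq_single _ X]
  · simp
  · intro Z hZ
    simp [hZ.symm]

lemma lindbladOp_eq_diagonal (γ : ℝ) (x : S) :
    lindbladOp γ x
      = Matrix.diagonal fun X => ((Real.sqrt (4 * γ) : ℝ) : ℂ) * if x ∈ X then 1 else 0 := by
  rw [lindbladOp, num_eq_diagonal]
  ext X Y
  simp [Matrix.diagonal_apply]

lemma lindbladOp_conjTranspose (γ : ℝ) (x : S) : (lindbladOp γ x)ᴴ = lindbladOp γ x := by
  rw [lindbladOp_eq_diagonal, Matrix.diagonal_conjTranspose]
  congr 1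
  ext X
  rw [Pi.star_apply]
  split_ifs <;> simp only [mul_one, mul_zero, star_zero, RCLike.star_def, Complex.conj_ofReal]

/-- Dephasing at site `x` damps the coherences between configurations that differ at `x`. -/
lemma dissipator_apply {γ : ℝ} (hγ : 0 ≤ γ) (x : S) (ρ : Op S) (X Y : Finset S) :
    dissipator γ x ρ X Y = if x ∈ symmDiff X Y then -(2 * γ : ℂ) * ρ X Y else 0 := by
  have hs : ((Real.sqrt (4 * γ) : ℝ) : ℂ) * ((Real.sqrt (4 * γ) : ℝ) : ℂ) = 4 * γ := by
    rw [← Complex.ofReal_mul, Real.mul_self_sqrt (by positivity)]; simp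
  have hL := lindbladOp_eq_diagonal γ x
  rw [dissipator, lindbladOp_conjTranspose]
  generalize ((Real.sqrt (4 * γ) : ℝ) : ℂ) = s at hs hL
  have hLL : opMul (lindbladOp γ x) (lindbladOp γ x)
      = Matrix.diagonal fun X => (4 * γ : ℂ) * if x ∈ X then 1 else 0 := by
    ext X Y
    rw [hL, diagonal_opMul, Matrix.diagonal_apply, Matrix.diagonal_apply]
    split_ifs <;> simp [hs]
  rw [hLL]
  simp only [Matrix.sub_apply, Matrix.smul_apply, Matrix.add_apply, opMul_diagonal,
    diagonal_opMul, hL, smul_eq_mul, Finset.mem_symmDiff]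
  by_cases hX : x ∈ X <;> by_cases hY : x ∈ Y <;> simp [hX, hY]
  · linear_combination (ρ X Y) * hs
  · ring
  · ring

lemma finsum_dissipator {γ : ℝ} (hγ : 0 ≤ γ) (ρ : Op S) (X Y : Finset S) :
    ∑ᶠ x : S, dissipator γ x ρ X Y = -(2 * γ * (symmDiff X Y).card : ℂ) * ρ X Y := by
  simp_rw [dissipator_apply hγ]
  rw [finsum_eq_sum_of_support_subset (s := symmDiff X Y)]
  · rw [Finset.sum_ite_mem, Finset.inter_self, Finset.sum_const, nsmul_eq_mul]; ring
  · intro x hx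
    by_contra h
    exact hx (if_neg h)

lemma symmDiff_insert_insert {x : S} {X Y : Finset S} (hX : x ∉ X) (hY : x ∉ Y) :
    symmDiff (insert x X) (insert x Y) = symmDiff X Y := by
  ext y
  simp only [Finset.mem_symmDiff, Finset.mem_insert]
  grind

lemma symmDiff_erase_erase {x : S} {X Y : Finset S} (hX : x ∈ X) (hY : x ∈ Y) :
    symmDiff (X.erase x) (Y.erase x) = symmDiff X Y := by
  ext y
  simp only [Finset.mem_symmDiff, Finset.mem_erase]
  grind

/-! ### Particle removal and insertion commute with the Liouvillian -/

section Finite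
variable [Fintype S]

/-- The hopping operator `a†_c a_d + a†_d a_c` on a bond. -/
def hop (c d : S) : Op S := create c * annih d + create d * annih c

lemma hamiltonian_eq_sum :
    hamiltonian S = -∑ b : {b : S × S // (b.2 : ℤ) = b.1 + 1}, hop b.1.1 b.1.2 := by
  ext X Y
  rw [hamiltonian, finsum_eq_sum_of_fintype, Matrix.neg_apply, Matrix.sum_apply]
  simp_rw [opMul_eq_mul, hop]

/-- The sum `ρ ↦ ∑_x a_x ρ a†_x`, which removes one particle at the same site from both sides. -/
def lowering (ρ : Op S) : Op S := ∑ x, annih x * ρ * create x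

/-- The sum `ρ ↦ ∑_x a†_x ρ a_x`, which adds one particle at the same site to both sides. -/
def raising (ρ : Op S) : Op S := ∑ x, create x * ρ * annih x

/-- The two boundary terms of `[a†_c a_d, ·]`, from `a_x` and from `a†_x`, cancel after summation over
`x`, since hopping is quadratic and conserves the number of particles. -/
lemma hop_commutator_lowering (c d : S) (ρ : Op S) :
    hop c d * lowering ρ - lowering ρ * hop c d = lowering (hop c d * ρ - ρ * hop c d) := by
  have h1 : ∀ x, hop c d * (annih x * ρ * create x) = annih x * (hop c d * ρ) * create x
      - ((if x = c then annih d * ρ * create x else 0)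
        + (if x = d then annih c * ρ * create x else 0)) := by
    intro x
    have : hop c d * annih x = annih x * hop c d
        - ((if x = c then annih d else 0) + (if x = d then annih c else 0)) := by
      rw [hop, add_mul, hop_mul_annih, hop_mul_annih, mul_add]; abel
    rw [← mul_assoc, ← mul_assoc, this]
    split_ifs <;> simp [sub_mul, add_mul, mul_assoc]
  have h2 : ∀ x, annih x * ρ * create x * hop c d = annih x * (ρ * hop c d) * create x
      - ((if d = x then annih x * ρ * create c else 0)
        + (if c = x then annih x * ρ * create d else 0)) := by
    intro x
    have : create x * hop c d = hop c d * create x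
        - ((if d = x then create c else 0) + (if c = x then create d else 0)) := by
      rw [hop, add_mul, hop_mul_create, hop_mul_create, mul_add]; abel
    rw [mul_assoc, this]
    split_ifs <;> simp [mul_sub, mul_add, mul_assoc]
  simp only [lowering, Finset.mul_sum, Finset.sum_mul]
  simp_rw [h1, h2, mul_sub, sub_mul, Finset.sum_sub_distrib, Finset.sum_add_distrib]
  simp only [Finset.sum_ite_eq, Finset.sum_ite_eq', Finset.mem_univ, if_true]
  abel

lemma hop_commutator_raising (c d : S) (ρ : Op S) :
    hop c d * raising ρ - raising ρ * hop c d = raising (hop c d * ρ - ρ * hop c d) := by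
  have h1 : ∀ x, hop c d * (create x * ρ * annih x) = create x * (hop c d * ρ) * annih x
      + ((if d = x then create c * ρ * annih x else 0)
        + (if c = x then create d * ρ * annih x else 0)) := by
    intro x
    have : hop c d * create x = create x * hop c d
        + ((if d = x then create c else 0) + (if c = x then create d else 0)) := by
      rw [hop, add_mul, hop_mul_create, hop_mul_create, mul_add]; abel
    rw [← mul_assoc, ← mul_assoc, this]
    split_ifs <;> simp [add_mul, mul_assoc]
  have h2 : ∀ x, create x * ρ * annih x * hop c d = create x * (ρ * hop c d) * annih x
      + ((if x = c then create x * ρ * annih d else 0)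
        + (if x = d then create x * ρ * annih c else 0)) := by
    intro x
    have : annih x * hop c d = hop c d * annih x
        + ((if x = c then annih d else 0) + (if x = d then annih c else 0)) := by
      rw [hop, add_mul, hop_mul_annih, hop_mul_annih, mul_add]; abel
    rw [mul_assoc, this]
    split_ifs <;> simp [mul_add, mul_assoc]
  simp only [raising, Finset.mul_sum, Finset.sum_mul]
  simp_rw [h1, h2, mul_sub, sub_mul, Finset.sum_sub_distrib, Finset.sum_add_distrib]
  simp only [Finset.sum_ite_eq, Finset.sum_ite_eq', Finset.mem_univ, if_true]
  abel

lemma lowering_apply (ρ : Op S) (X Y : Finset S) :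
    lowering ρ X Y = ∑ x, if x ∉ X ∧ x ∉ Y then
      jwSign X x * jwSign Y x * ρ (insert x X) (insert x Y) else 0 := by
  rw [lowering, Matrix.sum_apply]
  refine Finset.sum_congr rfl fun x _ => ?_
  rw [mul_create_apply, annih_mul_apply]
  by_cases hX : x ∈ X <;> by_cases hY : x ∈ Y <;> simp [hX, hY]
  ring

lemma raising_apply (ρ : Op S) (X Y : Finset S) :
    raising ρ X Y = ∑ x, if x ∈ X ∧ x ∈ Y then
      jwSign (X.erase x) x * jwSign (Y.erase x) x * ρ (X.erase x) (Y.erase x) else 0 := by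
  rw [raising, Matrix.sum_apply]
  refine Finset.sum_congr rfl fun x _ => ?_
  rw [mul_annih_apply, create_mul_apply]
  by_cases hX : x ∈ X <;> by_cases hY : x ∈ Y <;> simp [hX, hY]
  ring

lemma lowering_sum {ι : Type*} (s : Finset ι) (f : ι → Op S) :
    lowering (∑ i ∈ s, f i) = ∑ i ∈ s, lowering (f i) := by
  simp only [lowering, Finset.mul_sum, Finset.sum_mul]
  rw [Finset.sum_comm]

lemma raising_sum {ι : Type*} (s : Finset ι) (f : ι → Op S) :
    raising (∑ i ∈ s, f i) = ∑ i ∈ s, raising (f i) := by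
  simp only [raising, Finset.mul_sum, Finset.sum_mul]
  rw [Finset.sum_comm]

lemma hamiltonian_commutator (ρ : Op S) :
    hamiltonian S * ρ - ρ * hamiltonian S
      = -∑ b : {b : S × S // (b.2 : ℤ) = b.1 + 1},
          (hop b.1.1 b.1.2 * ρ - ρ * hop b.1.1 b.1.2) := by
  rw [hamiltonian_eq_sum, Finset.sum_sub_distrib, neg_mul, mul_neg, Finset.sum_mul,
    Finset.mul_sum]
  abel

lemma liouvillian_eq {γ : ℝ} (hγ : 0 ≤ γ) (ρ : Op S) :
    liouvillian γ ρ = -Complex.I • (hamiltonian S * ρ - ρ * hamiltonian S)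
      + Matrix.of fun X Y => -(2 * γ * (symmDiff X Y).card : ℂ) * ρ X Y := by
  ext X Y
  rw [liouvillian, finsum_dissipator hγ]
  simp [opMul_eq_mul]

/-- The Liouvillian commutes with `ρ ↦ ∑_x a_x ρ a†_x`. -/
lemma liouvillian_lowering {γ : ℝ} (hγ : 0 ≤ γ) (ρ : Op S) :
    liouvillian γ (lowering ρ) = lowering (liouvillian γ ρ) := by
  have h1 : hamiltonian S * lowering ρ - lowering ρ * hamiltonian S
      = lowering (hamiltonian S * ρ - ρ * hamiltonian S) := by
    have hneg : ∀ A : Op S, lowering (-A) = -lowering A := fun A => by simp [lowering]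
    rw [hamiltonian_commutator, hamiltonian_commutator, hneg, lowering_sum]
    simp_rw [hop_commutator_lowering]
  rw [liouvillian_eq hγ, liouvillian_eq hγ, h1]
  ext X Y
  simp only [Matrix.add_apply, Matrix.smul_apply, lowering_apply, Matrix.of_apply,
    Finset.mul_sum, smul_eq_mul]
  rw [← Finset.sum_add_distrib]
  refine Finset.sum_congr rfl fun x _ => ?_
  split_ifs with h
  · rw [symmDiff_insert_insert h.1 h.2]; ring
  · simp

/-- The Liouvillian commutes with `ρ ↦ ∑_x a†_x ρ a_x`. -/
lemma liouvillian_raising {γ : ℝ} (hγ : 0 ≤ γ) (ρ : Op S) :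
    liouvillian γ (raising ρ) = raising (liouvillian γ ρ) := by
  have h1 : hamiltonian S * raising ρ - raising ρ * hamiltonian S
      = raising (hamiltonian S * ρ - ρ * hamiltonian S) := by
    have hneg : ∀ A : Op S, raising (-A) = -raising A := fun A => by simp [raising]
    rw [hamiltonian_commutator, hamiltonian_commutator, hneg, raising_sum]
    simp_rw [hop_commutator_raising]
  rw [liouvillian_eq hγ, liouvillian_eq hγ, h1]
  ext X Y
  simp only [Matrix.add_apply, Matrix.smul_apply, raising_apply, Matrix.of_apply,
    Finset.mul_sum, smul_eq_mul]
  rw [← Finset.sum_add_distrib]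
  refine Finset.sum_congr rfl fun x _ => ?_
  split_ifs with h
  · rw [symmDiff_erase_erase h.1 h.2]; ring
  · simp

lemma lowering_ketBra (Y : Finset S) : lowering (ketBra Y) = ∑ y ∈ Y, ketBra (Y.erase y) := by
  ext X Z
  rw [lowering_apply, Matrix.sum_apply, ← Finset.sum_ite_mem_eq Y]
  refine Finset.sum_congr rfl fun x _ => ?_
  simp only [ketBra, Matrix.single_apply]
  by_cases hX : x ∈ X
  · have : Y.erase x ≠ X := by rintro rfl; simp at hX
    simp [hX, this]
  by_cases hZ : x ∈ Z
  · have : Y.erase x ≠ Z := by rintro rfl; simp at hZ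
    simp [hZ, this]
  by_cases hY : x ∈ Y
  · have e : ∀ W : Finset S, x ∉ W → (Y = insert x W ↔ Y.erase x = W) := by
      intro W hW
      constructor
      · rintro rfl; simp [hW]
      · rintro rfl; simp [hY]
    simp only [hX, hZ, hY, not_false_eq_true, and_self, if_true, e X hX, e Z hZ]
    split_ifs with h
    · rw [← h.1, ← h.2, jwSign_mul_self, one_mul]
    · simp
  · have : Y ≠ insert x X := by rintro rfl; simp at hY
    simp [hX, hZ, hY, this]

lemma raising_ketBra (Y : Finset S) : raising (ketBra Y) = ∑ y ∈ Yᶜ, ketBra (insert y Y) := by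
  ext X Z
  rw [raising_apply, Matrix.sum_apply, ← Finset.sum_ite_mem_eq Yᶜ]
  refine Finset.sum_congr rfl fun x _ => ?_
  simp only [ketBra, Matrix.single_apply, Finset.mem_compl]
  by_cases hX : x ∈ X
  swap
  · have : insert x Y ≠ X := by rintro rfl; simp at hX
    simp [hX, this]
  by_cases hZ : x ∈ Z
  swap
  · have : insert x Y ≠ Z := by rintro rfl; simp at hZ
    simp [hZ, this]
  by_cases hY : x ∈ Y
  · have : Y ≠ X.erase x := by rintro rfl; simp at hY
    simp [hX, hZ, hY, this]
  · have e : ∀ W : Finset S, x ∈ W → (Y = W.erase x ↔ insert x Y = W) := by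
      intro W hW
      constructor
      · rintro rfl; simp [hW]
      · rintro rfl; simp [hY]
    simp only [hX, hZ, hY, not_false_eq_true, and_self, if_true, e X hX, e Z hZ]
    split_ifs with h
    · rw [← h.1, ← h.2, jwSign_mul_self, one_mul]
    · simp

lemma lowering_apply_self (ρ : Op S) (X : Finset S) :
    lowering ρ X X = ∑ x ∈ Xᶜ, ρ (insert x X) (insert x X) := by
  rw [lowering_apply, ← Finset.sum_ite_mem_eq Xᶜ]
  simp [jwSign_mul_self]

lemma raising_apply_self (ρ : Op S) (X : Finset S) :
    raising ρ X X = ∑ x ∈ X, ρ (X.erase x) (X.erase x) := by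
  rw [raising_apply, ← Finset.sum_ite_mem_eq X]
  simp [jwSign_mul_self]

end Finite

end Fock

/-! ### Exponentials in Banach algebras -/

section Exponential
variable {𝔸 : Type*} [NormedRing 𝔸] [NormOneClass 𝔸]

lemma norm_pow_sub_pow_le {a b : 𝔸} {M : ℝ} (hM : 1 ≤ M) (ha : ‖a‖ ≤ M) (hb : ‖b‖ ≤ M) (k : ℕ) :
    ‖a ^ k - b ^ k‖ ≤ k * M ^ k * ‖a - b‖ := by
  induction k with
  | zero => simp
  | succ k ih =>
    have hM0 : 0 ≤ M := by linarith
    have e : a ^ (k + 1) - b ^ (k + 1) = a * (a ^ k - b ^ k) + (a - b) * b ^ k := by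
      rw [pow_succ' a, pow_succ' b]; noncomm_ring
    have hbk : ‖b ^ k‖ ≤ M ^ (k + 1) :=
      (norm_pow_le b k).trans ((pow_le_pow_left₀ (norm_nonneg b) hb k).trans
        (pow_le_pow_right₀ hM (Nat.le_succ k)))
    calc ‖a ^ (k + 1) - b ^ (k + 1)‖
        ≤ ‖a‖ * ‖a ^ k - b ^ k‖ + ‖a - b‖ * ‖b ^ k‖ := by
          rw [e]
          exact (norm_add_le _ _).trans (add_le_add (norm_mul_le _ _) (norm_mul_le _ _))
      _ ≤ M * (k * M ^ k * ‖a - b‖) + ‖a - b‖ * M ^ (k + 1) := by gcongr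
      _ = ((k + 1 : ℕ) : ℝ) * M ^ (k + 1) * ‖a - b‖ := by push_cast; ring

variable [NormedAlgebra ℂ 𝔸] [CompleteSpace 𝔸]

lemma norm_exp_le_exp_norm (x : 𝔸) : ‖NormedSpace.exp x‖ ≤ Real.exp ‖x‖ := by
  have h := NormedSpace.exp_series_hasSum_exp' (𝕂 := ℂ) x
  have h2 : HasSum (fun n : ℕ => ((n.factorial : ℝ)⁻¹) • ‖x‖ ^ n) (Real.exp ‖x‖) := by
    rw [Real.exp_eq_exp_ℝ]
    exact NormedSpace.exp_series_hasSum_exp' (𝕂 := ℝ) ‖x‖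
  rw [← h.tsum_eq]
  refine tsum_of_norm_bounded h2 fun n => ?_
  rw [norm_smul, norm_inv, Complex.norm_natCast, smul_eq_mul]
  gcongr
  exact norm_pow_le x n

/-- `(1 + x/n + y/n²)^n → exp x`, also when `x` and `y` do not commute. -/
lemma tendsto_one_add_div_pow_exp (x y : 𝔸) :
    Filter.Tendsto (fun n : ℕ => (1 + ((n : ℂ)⁻¹) • x + ((n : ℂ)⁻¹ ^ 2) • y) ^ n) Filter.atTop
      (nhds (NormedSpace.exp x)) := by
  -- telescoping `P^n - E^n` with `E = exp (x / n)` leaves `n (P - E)`, which tends to zero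
  set c : ℝ := ‖x‖ + ‖y‖
  set P : ℕ → 𝔸 := fun n => 1 + ((n : ℂ)⁻¹) • x + ((n : ℂ)⁻¹ ^ 2) • y with hP
  set E : ℕ → 𝔸 := fun n => NormedSpace.exp (((n : ℂ)⁻¹) • x) with hE
  have hinv : Filter.Tendsto (fun n : ℕ => (n : ℂ)⁻¹) Filter.atTop (nhds 0) :=
    tendsto_inv_atTop_nhds_zero_nat
  have hslope : Filter.Tendsto (fun n : ℕ => (n : ℂ) • (E n - 1)) Filter.atTop (nhds x) := by
    have h := hasDerivAt_exp_smul_const (𝕂 := ℂ) x 0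
    rw [hasDerivAt_iff_tendsto_slope] at h
    have h2 : Filter.Tendsto (fun n : ℕ => (n : ℂ)⁻¹) Filter.atTop (nhdsWithin 0 {0}ᶜ) := by
      refine tendsto_nhdsWithin_iff.2 ⟨hinv, ?_⟩
      filter_upwards [Filter.eventually_gt_atTop 0] with n hn
      simp [hn.ne']
    have h3 := h.comp h2
    simp only [zero_smul, NormedSpace.exp_zero, one_mul] at h3
    refine h3.congr fun n => ?_
    simp [slope_def_module, hE]
  have hdiff : Filter.Tendsto (fun n : ℕ => ‖(n : ℂ) • (P n - E n)‖) Filter.atTop (nhds 0) := by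
    have h1 : Filter.Tendsto (fun n : ℕ => x + ((n : ℂ)⁻¹) • y - (n : ℂ) • (E n - 1))
        Filter.atTop (nhds (x + (0 : ℂ) • y - x)) :=
      (tendsto_const_nhds.add (hinv.smul_const y)).sub hslope
    have h2 := h1.norm
    simp only [zero_smul, add_zero, sub_self, norm_zero] at h2
    refine h2.congr' ?_
    filter_upwards [Filter.eventually_gt_atTop 0] with n hn
    congr 1
    have hn' : (n : ℂ) ≠ 0 := by exact_mod_cast hn.ne'
    simp only [hP, smul_sub, smul_add, smul_smul, pow_two]
    rw [← mul_assoc, mul_inv_cancel₀ hn', one_mul, one_smul]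
    abel
  have hE_pow : ∀ᶠ n : ℕ in Filter.atTop, E n ^ n = NormedSpace.exp x := by
    filter_upwards [Filter.eventually_gt_atTop 0] with n hn
    have hn' : (n : ℂ) ≠ 0 := by exact_mod_cast hn.ne'
    let : NormedAlgebra ℚ 𝔸 := NormedAlgebra.restrictScalars ℚ ℂ 𝔸
    rw [hE]
    simp only
    rw [← NormedSpace.exp_nsmul, ← Nat.cast_smul_eq_nsmul ℂ, smul_smul, mul_inv_cancel₀ hn',
      one_smul]
  rw [tendsto_iff_norm_sub_tendsto_zero]
  have hb := (hdiff.mul_const (Real.exp c))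
  rw [zero_mul] at hb
  refine squeeze_zero' (Filter.Eventually.of_forall fun n => norm_nonneg _) ?_ hb
  filter_upwards [hE_pow, Filter.eventually_gt_atTop 0] with n hn hn0
  have hn1 : (1 : ℝ) ≤ n := by exact_mod_cast hn0
  have hni : (n : ℝ)⁻¹ ≤ 1 := inv_le_one_of_one_le₀ hn1
  have hc : 0 ≤ c := by positivity
  have hPn : ‖P n‖ ≤ Real.exp (c / n) := by
    calc ‖P n‖ ≤ 1 + (n : ℝ)⁻¹ * ‖x‖ + ((n : ℝ)⁻¹ ^ 2) * ‖y‖ := by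
          refine (norm_add_le _ _).trans (add_le_add ((norm_add_le _ _).trans ?_) ?_)
          · rw [norm_one, norm_smul, norm_inv, Complex.norm_natCast]
          · rw [norm_smul, norm_pow, norm_inv, Complex.norm_natCast]
      _ ≤ 1 + (n : ℝ)⁻¹ * ‖x‖ + (n : ℝ)⁻¹ * ‖y‖ := by
          gcongr
          rw [pow_two]
          exact mul_le_of_le_one_right (by positivity) hni
      _ = c / n + 1 := by simp only [c]; ring
      _ ≤ Real.exp (c / n) := Real.add_one_le_exp _
  have hEn : ‖E n‖ ≤ Real.exp (c / n) := by
    refine (norm_exp_le_exp_norm _).trans (Real.exp_le_exp.2 ?_)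
    rw [norm_smul, norm_inv, Complex.norm_natCast, div_eq_inv_mul]
    gcongr
    simp [c]
  have h1 : 1 ≤ Real.exp (c / n) := Real.one_le_exp (by positivity)
  calc ‖P n ^ n - NormedSpace.exp x‖ = ‖P n ^ n - E n ^ n‖ := by rw [hn]
    _ ≤ n * Real.exp (c / n) ^ n * ‖P n - E n‖ := norm_pow_sub_pow_le h1 hPn hEn n
    _ = ‖(n : ℂ) • (P n - E n)‖ * Real.exp c := by
      rw [← Real.exp_nat_mul, mul_div_cancel₀ _ (by positivity : (n : ℝ) ≠ 0), norm_smul,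
        Complex.norm_natCast]
      ring

lemma hasSum_exp_smul {𝔸 : Type*} [NormedRing 𝔸] [NormedAlgebra ℂ 𝔸] [CompleteSpace 𝔸] (c : ℂ)
    (x : 𝔸) :
    HasSum (fun k : ℕ => (c ^ k / (k.factorial : ℂ)) • x ^ k) (NormedSpace.exp (c • x)) := by
  refine (NormedSpace.exp_series_hasSum_exp' (𝕂 := ℂ) (c • x)).congr_fun fun k => ?_
  rw [smul_pow, smul_smul, div_eq_inv_mul]

lemma commute_exp_smul {𝔸 : Type*} [NormedRing 𝔸] [NormedAlgebra ℂ 𝔸] {a b : 𝔸}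
    (h : Commute a b) (c : ℂ) : Commute a (NormedSpace.exp (c • b)) :=
  (h.smul_right c).exp_right

end Exponential

/-! ### The evolution of a finite lattice -/

section Semigroup

lemma card_symmDiff_add {α : Type*} [DecidableEq α] (X Y : Finset α) :
    (symmDiff X Y).card + 2 * (X ∩ Y).card = X.card + Y.card := by
  have h1 := Finset.card_sdiff_add_card_inter X Y
  have h2 := Finset.card_sdiff_add_card_inter Y X
  have h3 : (symmDiff X Y).card = (X \ Y).card + (Y \ X).card :=
    Finset.card_union_of_disjoint disjoint_sdiff_sdiff
  rw [Finset.inter_comm] at h2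
  omega

variable {S : Set ℤ}

section
open scoped ComplexOrder

lemma ketBra_posSemidef (Y : Finset S) : (ketBra Y).PosSemidef := by
  have : ketBra Y = Matrix.diagonal (Pi.single Y (1 : ℂ)) := by
    rw [ketBra, Matrix.diagonal_single]
  rw [this]
  refine Matrix.PosSemidef.diagonal ?_
  intro Z
  by_cases h : Z = Y
  · subst h; simp
  · simp [h]

end

/-- Operators as functions of two configurations. This carries the supremum norm, while `Matrix`
carries no norm. -/
abbrev OpFun (S : Set ℤ) := Finset S → Finset S → ℂ

/-- The action of a superoperator on an operator. -/
def act (Φ : OpFun S →L[ℂ] OpFun S) (ρ : Op S) : Op S := Matrix.of (Φ (Matrix.of.symm ρ))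

lemma act_one (ρ : Op S) : act 1 ρ = ρ := rfl

lemma act_mul (Φ Ψ : OpFun S →L[ℂ] OpFun S) (ρ : Op S) : act (Φ * Ψ) ρ = act Φ (act Ψ ρ) := rfl

lemma act_add (Φ Ψ : OpFun S →L[ℂ] OpFun S) (ρ : Op S) :
    act (Φ + Ψ) ρ = act Φ ρ + act Ψ ρ := rfl

lemma act_smul (c : ℂ) (Φ : OpFun S →L[ℂ] OpFun S) (ρ : Op S) :
    act (c • Φ) ρ = c • act Φ ρ := rfl

lemma act_sum {ι : Type*} (s : Finset ι) (Φ : ι → OpFun S →L[ℂ] OpFun S) (ρ : Op S) :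
    act (∑ i ∈ s, Φ i) ρ = ∑ i ∈ s, act (Φ i) ρ := by
  induction s using Finset.cons_induction with
  | empty => rfl
  | cons a s h ih => rw [Finset.sum_cons, Finset.sum_cons, act_add, ih]

lemma act_sum_smul {ι : Type*} (Φ : OpFun S →L[ℂ] OpFun S) (s : Finset ι) (c : ι → ℂ)
    (ρ : ι → Op S) : act Φ (∑ i ∈ s, c i • ρ i) = ∑ i ∈ s, c i • act Φ (ρ i) := by
  induction s using Finset.cons_induction with
  | empty =>
    have : Φ 0 = 0 := map_zero Φ
    exact this
  | cons a s h ih =>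
    rw [Finset.sum_cons, Finset.sum_cons, ← ih]
    change Φ (c a • Matrix.of.symm (ρ a) + Matrix.of.symm (∑ i ∈ s, c i • ρ i)) = _
    rw [map_add, map_smul]
    rfl

variable [Fintype S]

/-- Evaluation of a matrix element, as a continuous linear functional of the superoperator. -/
def evalCLM (ρ : Op S) (X Y : Finset S) : (OpFun S →L[ℂ] OpFun S) →L[ℂ] ℂ :=
  (ContinuousLinearMap.proj Y).comp ((ContinuousLinearMap.proj X).comp
    (ContinuousLinearMap.apply ℂ (OpFun S) (Matrix.of.symm ρ)))

lemma evalCLM_apply (ρ : Op S) (X Y : Finset S) (Φ : OpFun S →L[ℂ] OpFun S) :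
    evalCLM ρ X Y Φ = act Φ ρ X Y := rfl

/-- The superoperator `ρ ↦ A ρ B`. -/
def sandwich (A B : Op S) : OpFun S →L[ℂ] OpFun S :=
  LinearMap.toContinuousLinearMap
    { toFun := fun ρ => (A * (Matrix.of ρ) * B : Op S)
      map_add' := fun ρ σ => by
        change A * (Matrix.of ρ + Matrix.of σ) * B = A * Matrix.of ρ * B + A * Matrix.of σ * B
        rw [Matrix.mul_add, Matrix.add_mul]
      map_smul' := fun c ρ => by
        change A * (c • Matrix.of ρ) * B = c • (A * Matrix.of ρ * B)
        rw [Matrix.mul_smul, Matrix.smul_mul] }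

lemma act_sandwich (A B ρ : Op S) : act (sandwich A B) ρ = A * ρ * B := rfl

/-- The effective non-Hermitian generator `K = -i H - ½ ∑_x L_x† L_x = -i H - 2γ ∑_x n_x`. -/
def effectiveGenerator (S : Set ℤ) [Fintype S] (γ : ℝ) : Op S :=
  -Complex.I • hamiltonian S - (2 * γ : ℂ) • ∑ x, num x

/-- The Liouvillian in the form `ρ ↦ K ρ + ρ K† + 4γ ∑_x n_x ρ n_x`. -/
def liouvillianCLM (S : Set ℤ) [Fintype S] (γ : ℝ) : OpFun S →L[ℂ] OpFun S :=
  sandwich (effectiveGenerator S γ) 1 + sandwich 1 (effectiveGenerator S γ)ᴴ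
    + (4 * γ : ℂ) • ∑ x, sandwich (num x) (num x)

lemma hop_conjTranspose (c d : S) : (hop c d)ᴴ = hop c d := by
  rw [hop, Matrix.conjTranspose_add, Matrix.conjTranspose_mul, Matrix.conjTranspose_mul,
    conjTranspose_annih, conjTranspose_annih, annih, annih, add_comm]

lemma hamiltonian_conjTranspose : (hamiltonian S)ᴴ = hamiltonian S := by
  rw [hamiltonian_eq_sum, Matrix.conjTranspose_neg, Matrix.conjTranspose_sum]
  simp_rw [hop_conjTranspose]

lemma sum_num : ∑ x, num x = Matrix.diagonal fun X : Finset S => (X.card : ℂ) := by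
  ext X Y
  rw [Matrix.sum_apply]
  simp_rw [num_eq_diagonal, Matrix.diagonal_apply]
  split_ifs <;> simp

lemma act_sum_sandwich_num (ρ : Op S) (X Y : Finset S) :
    act (∑ x, sandwich (num x) (num x)) ρ X Y = ((X ∩ Y).card : ℂ) * ρ X Y := by
  rw [act_sum, Matrix.sum_apply]
  simp_rw [act_sandwich, num_eq_diagonal, Matrix.mul_diagonal, Matrix.diagonal_mul]
  rw [← nsmul_eq_mul, ← Finset.sum_const, ← Finset.sum_ite_mem_eq (X ∩ Y)]
  refine Finset.sum_congr rfl fun x _ => ?_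
  by_cases hX : x ∈ X <;> by_cases hY : x ∈ Y <;> simp [hX, hY]

lemma act_liouvillianCLM {γ : ℝ} (hγ : 0 ≤ γ) (ρ : Op S) :
    act (liouvillianCLM S γ) ρ = liouvillian γ ρ := by
  rw [liouvillian_eq hγ, liouvillianCLM, act_add, act_add, act_smul, act_sandwich, act_sandwich]
  ext X Y
  have hc := card_symmDiff_add X Y
  have hc' : ((symmDiff X Y).card : ℂ) = X.card + Y.card - 2 * (X ∩ Y).card := by
    rw [eq_sub_iff_add_eq]; exact_mod_cast hc
  rw [Matrix.add_apply, Matrix.add_apply, Matrix.smul_apply, act_sum_sandwich_num,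
    effectiveGenerator,
    sum_num, Matrix.mul_one, Matrix.one_mul, Matrix.conjTranspose_sub,
    Matrix.conjTranspose_smul, Matrix.conjTranspose_smul, hamiltonian_conjTranspose,
    Matrix.diagonal_conjTranspose, Matrix.sub_mul, Matrix.mul_sub, Matrix.add_apply,
    Matrix.of_apply, hc']
  simp [Matrix.mul_diagonal, Matrix.diagonal_mul]
  ring

/-- The evolution semigroup of a finite lattice as an exponential in the Banach algebra of
superoperators. -/
def evolveCLM (S : Set ℤ) [Fintype S] (γ t : ℝ) : OpFun S →L[ℂ] OpFun S :=
  NormedSpace.exp ((t : ℂ) • liouvillianCLM S γ)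

lemma evolve_eq_act {γ : ℝ} (hγ : 0 ≤ γ) (t : ℝ) (ρ : Op S) :
    evolve γ t ρ = act (evolveCLM S γ t) ρ := by
  ext X Y
  have h := (evalCLM ρ X Y).hasSum
    (hasSum_exp_smul (t : ℂ) (liouvillianCLM S γ))
  rw [evolve]
  refine Eq.trans (tsum_congr fun k => ?_) h.tsum_eq
  have hk : ∀ k, act ((liouvillianCLM S γ) ^ k) ρ = (liouvillian γ)^[k] ρ := fun k => by
    induction k with
    | zero => rfl
    | succ k ih =>
      rw [pow_succ', Function.iterate_succ_apply', ← ih, ← act_liouvillianCLM hγ, act_mul]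
  rw [evolveTerm, ← hk, map_smul, evalCLM_apply, smul_eq_mul]

open scoped ComplexOrder

/-- The evolution maps positive semidefinite operators to operators with nonnegative diagonal. It
is the limit of the powers of the completely positive maps
`ρ ↦ (1 + (t/n) K) ρ (1 + (t/n) K)† + (t/n) 4γ ∑_x n_x ρ n_x`. -/
lemma act_evolveCLM_diag_nonneg {γ t : ℝ} (hγ : 0 ≤ γ) (ht : 0 ≤ t) {ρ : Op S}
    (hρ : ρ.PosSemidef) (X : Finset S) : 0 ≤ act (evolveCLM S γ t) ρ X X := by
  set K := effectiveGenerator S γ with hK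
  -- the second-order term turns the part without jumps into `ρ ↦ (1 + (t/n) K) ρ (1 + (t/n) K)†`,
  -- which is completely positive, and disappears in the limit
  set P : ℕ → OpFun S →L[ℂ] OpFun S := fun n => 1 + ((n : ℂ)⁻¹) • ((t : ℂ) • liouvillianCLM S γ)
    + ((n : ℂ)⁻¹ ^ 2) • ((t : ℂ) ^ 2 • sandwich K Kᴴ) with hP
  have hlim : Filter.Tendsto (fun n => P n ^ n) Filter.atTop (nhds (evolveCLM S γ t)) :=
    tendsto_one_add_div_pow_exp _ _
  have h1 := ((evalCLM ρ X X).continuous.tendsto _).comp hlim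
  have hnum : ∀ x : S, (num x)ᴴ = num x := fun x => by
    rw [num_eq_diagonal, Matrix.diagonal_conjTranspose]
    congr 1
    ext X
    rw [Pi.star_apply]
    split_ifs <;> simp
  have hform : ∀ n (σ : Op S), act (P n) σ
      = (1 + ((n : ℂ)⁻¹ * t) • K) * σ * (1 + ((n : ℂ)⁻¹ * t) • K)ᴴ
        + ((n : ℂ)⁻¹ * t * (4 * γ)) • ∑ x, num x * σ * (num x)ᴴ := by
    intro n σ
    simp only [hP, liouvillianCLM, ← hK, hnum, act_add, act_smul, act_sum, act_sandwich, act_one]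
    have hstar : star ((n : ℂ)⁻¹ * t) = (n : ℂ)⁻¹ * t := by simp
    rw [Matrix.conjTranspose_add, Matrix.conjTranspose_smul, hstar, Matrix.conjTranspose_one]
    simp only [Matrix.add_mul, Matrix.mul_add, Matrix.one_mul, Matrix.mul_one, smul_add,
      smul_smul, Matrix.smul_mul, Matrix.mul_smul]
    rw [show (n : ℂ)⁻¹ ^ 2 * (t : ℂ) ^ 2 = (n : ℂ)⁻¹ * t * ((n : ℂ)⁻¹ * t) by ring,
      mul_assoc _ (t : ℂ) (4 * γ : ℂ)]
    abel
  have hpos : ∀ n k, Matrix.PosSemidef (act (P n ^ k) ρ) := by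
    intro n k
    induction k with
    | zero => exact hρ
    | succ k ih =>
      rw [pow_succ', act_mul, hform]
      refine (ih.mul_mul_conjTranspose_same _).add (Matrix.PosSemidef.smul
        (Matrix.posSemidef_sum _ fun x _ => ih.mul_mul_conjTranspose_same _) ?_)
      have : (n : ℂ)⁻¹ * t * (4 * γ) = (((n : ℝ)⁻¹ * t * (4 * γ) : ℝ) : ℂ) := by push_cast; ring
      rw [this, Complex.zero_le_real]
      positivity
  exact ge_of_tendsto' h1 fun n => (hpos n n).diag_nonneg

/-- The classical transition weight `⟨X| e^{𝓛 t}[|Y⟩⟨Y|] |X⟩` between configurations. -/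
def transition (S : Set ℤ) (γ t : ℝ) (X Y : Finset S) : ℂ := evolve γ t (ketBra Y) X X

lemma transition_nonneg {γ t : ℝ} (hγ : 0 ≤ γ) (ht : 0 ≤ t) (X Y : Finset S) :
    0 ≤ transition S γ t X Y := by
  rw [transition, evolve_eq_act hγ]
  exact act_evolveCLM_diag_nonneg hγ ht (ketBra_posSemidef Y) X

/-- `ρ ↦ ∑_x a_x ρ a†_x` as a continuous linear map. -/
def loweringCLM (S : Set ℤ) [Fintype S] : OpFun S →L[ℂ] OpFun S :=
  ∑ x, sandwich (annih x) (create x)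

/-- `ρ ↦ ∑_x a†_x ρ a_x` as a continuous linear map. -/
def raisingCLM (S : Set ℤ) [Fintype S] : OpFun S →L[ℂ] OpFun S :=
  ∑ x, sandwich (create x) (annih x)

lemma act_loweringCLM (ρ : Op S) : act (loweringCLM S) ρ = lowering ρ := by
  rw [loweringCLM, lowering, act_sum]; rfl

lemma act_raisingCLM (ρ : Op S) : act (raisingCLM S) ρ = raising ρ := by
  rw [raisingCLM, raising, act_sum]; rfl

lemma act_evolveCLM_comm {γ : ℝ} (t : ℝ) {J : OpFun S →L[ℂ] OpFun S}
    (h : ∀ ρ, act J (act (liouvillianCLM S γ) ρ) = act (liouvillianCLM S γ) (act J ρ))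
    (ρ : Op S) : act (evolveCLM S γ t) (act J ρ) = act J (act (evolveCLM S γ t) ρ) := by
  have hc : Commute J (liouvillianCLM S γ) := ContinuousLinearMap.ext h
  rw [← act_mul, ← act_mul, evolveCLM, (commute_exp_smul hc t).eq]

/-- Removing a particle from the final configuration at any site amounts to removing one from the
initial configuration. -/
lemma sum_transition_insert {γ : ℝ} (hγ : 0 ≤ γ) (t : ℝ) (X Y : Finset S) :
    ∑ x ∈ Xᶜ, transition S γ t (insert x X) Y = ∑ y ∈ Y, transition S γ t X (Y.erase y) := by
  simp only [transition, evolve_eq_act hγ]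
  have h := act_evolveCLM_comm (γ := γ) t (J := loweringCLM S) (fun ρ => by
    simp_rw [act_liouvillianCLM hγ, act_loweringCLM, liouvillian_lowering hγ]) (ketBra Y)
  have h1 := act_sum_smul (evolveCLM S γ t) Y (fun _ => 1) fun y => ketBra (Y.erase y)
  simp only [one_smul] at h1
  rw [act_loweringCLM, act_loweringCLM, lowering_ketBra, h1] at h
  rw [← lowering_apply_self, ← h, Matrix.sum_apply]

/-- Adding a particle to the initial configuration at any site amounts to adding one to the final
configuration. -/
lemma sum_transition_erase {γ : ℝ} (hγ : 0 ≤ γ) (t : ℝ) (X Y : Finset S) :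
    ∑ y ∈ Yᶜ, transition S γ t X (insert y Y) = ∑ x ∈ X, transition S γ t (X.erase x) Y := by
  simp only [transition, evolve_eq_act hγ]
  have h := act_evolveCLM_comm (γ := γ) t (J := raisingCLM S) (fun ρ => by
    simp_rw [act_liouvillianCLM hγ, act_raisingCLM, liouvillian_raising hγ]) (ketBra Y)
  have h1 := act_sum_smul (evolveCLM S γ t) Yᶜ (fun _ => 1) fun y => ketBra (insert y Y)
  simp only [one_smul] at h1
  rw [act_raisingCLM, act_raisingCLM, raising_ketBra, h1] at h
  rw [← raising_apply_self, ← h, Matrix.sum_apply]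

/-- The evolution of a diagonal operator. -/
lemma evolve_diagonal_apply {γ : ℝ} (hγ : 0 ≤ γ) (t : ℝ) (d : Finset S → ℂ) (X : Finset S) :
    evolve γ t (Matrix.diagonal d) X X = ∑ Y, d Y * transition S γ t X Y := by
  have hd : Matrix.diagonal d = ∑ Y, d Y • ketBra Y := by
    ext A B
    rw [Matrix.sum_apply]
    simp only [Matrix.smul_apply, ketBra, Matrix.single_apply, Matrix.diagonal_apply]
    by_cases h : A = B
    · subst h; simp
    · rw [if_neg h, Finset.sum_eq_zero]
      intro Y _
      rw [if_neg (fun hY => h (hY.1.symm.trans hY.2)), smul_zero]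
  simp only [transition, evolve_eq_act hγ]
  rw [hd, act_sum_smul, Matrix.sum_apply]
  rfl

end Semigroup

/-! ### Self-dual kernels and step initial measures -/

section Duality
variable {Λ : Type*} [DecidableEq Λ]

lemma sum_powerset_sum_erase (f : Finset Λ → ℂ) (Y : Finset Λ) :
    ∑ Y' ∈ Y.powerset, ∑ y ∈ Y', f (Y'.erase y)
      = ∑ Y' ∈ Y.powerset, ((Y \ Y').card : ℂ) * f Y' := by
  have h : ∀ Y' : Finset Λ, ((Y \ Y').card : ℂ) * f Y' = ∑ _y ∈ Y \ Y', f Y' := fun Y' => by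
    rw [Finset.sum_const, nsmul_eq_mul]
  simp_rw [h]
  rw [Finset.sum_sigma', Finset.sum_sigma']
  refine Finset.sum_bij' (fun p _ => ⟨p.1.erase p.2, p.2⟩) (fun p _ => ⟨insert p.2 p.1, p.2⟩)
    ?_ ?_ ?_ ?_ ?_
  · rintro ⟨Y', y⟩ h
    simp only [Finset.mem_sigma, Finset.mem_powerset, Finset.mem_sdiff] at h ⊢
    exact ⟨(Finset.erase_subset _ _).trans h.1, h.1 h.2, by simp⟩
  · rintro ⟨Y', y⟩ h
    simp only [Finset.mem_sigma, Finset.mem_powerset, Finset.mem_sdiff] at h ⊢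
    exact ⟨Finset.insert_subset h.2.1 h.1, by simp⟩
  · rintro ⟨Y', y⟩ h
    simp only [Finset.mem_sigma, Finset.mem_powerset] at h
    simp [Finset.insert_erase h.2]
  · rintro ⟨Y', y⟩ h
    simp only [Finset.mem_sigma, Finset.mem_powerset, Finset.mem_sdiff] at h
    simp [Finset.erase_insert h.2.2]
  · rintro ⟨Y', y⟩ h
    rfl

variable [Fintype Λ]

lemma sum_compl_sum_superset (f : Finset Λ → ℂ) (X : Finset Λ) :
    ∑ x ∈ Xᶜ, ∑ X' with insert x X ⊆ X', f X'
      = ∑ X' with X ⊆ X', ((X' \ X).card : ℂ) * f X' := by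
  have h : ∀ X' : Finset Λ, ((X' \ X).card : ℂ) * f X' = ∑ _x ∈ X' \ X, f X' := fun X' => by
    rw [Finset.sum_const, nsmul_eq_mul]
  simp_rw [h]
  rw [Finset.sum_comm' (t' := Finset.univ.filter fun X' => X ⊆ X') (s' := fun X' => X' \ X)]
  intro x X'
  simp only [Finset.mem_compl, Finset.mem_filter, Finset.mem_univ, true_and,
    Finset.insert_subset_iff, Finset.mem_sdiff]
  tauto

/-- A number-conserving kernel whose one-particle marginals intertwine, summed over all numbers of
removed particles. Both sides, multiplied by `|Y| - |X|`, satisfy the same recursion in `X`. -/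
lemma sum_superset_eq_sum_powerset {T : Finset Λ → Finset Λ → ℂ}
    (hN : ∀ X Y, X.card ≠ Y.card → T X Y = 0)
    (hT : ∀ X Y, ∑ x ∈ Xᶜ, T (insert x X) Y = ∑ y ∈ Y, T X (Y.erase y)) (X Y : Finset Λ) :
    ∑ X' with X ⊆ X', T X' Y = ∑ Y' ∈ Y.powerset, T X Y' := by
  rcases lt_or_ge Y.card X.card with hlt | hle
  · rw [Finset.sum_eq_zero, Finset.sum_eq_zero]
    · intro Y' hY'
      exact hN _ _ ((Finset.card_le_card (Finset.mem_powerset.1 hY')).trans_lt hlt).ne'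
    · intro X' hX'
      exact hN _ _ (hlt.trans_le (Finset.card_le_card (Finset.mem_filter.1 hX').2)).ne'
  obtain ⟨k, hk⟩ := Nat.exists_eq_add_of_le hle
  induction k generalizing X with
  | zero =>
    rw [Finset.sum_eq_single X, Finset.sum_eq_single Y]
    · intro Y' hY' hne
      refine hN _ _ fun h => hne (Finset.eq_of_subset_of_card_le (Finset.mem_powerset.1 hY') ?_)
      omega
    · simp
    · intro X' hX' hne
      refine hN _ _ fun h => hne
        (Finset.eq_of_subset_of_card_le (Finset.mem_filter.1 hX').2 ?_).symm
      omega
    · simp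
  | succ k ih =>
    have e1 : ∑ x ∈ Xᶜ, ∑ X' with insert x X ⊆ X', T X' Y
        = ((k + 1 : ℕ) : ℂ) * ∑ X' with X ⊆ X', T X' Y := by
      rw [sum_compl_sum_superset (fun X' => T X' Y), Finset.mul_sum]
      refine Finset.sum_congr rfl fun X' hX' => ?_
      by_cases h : X'.card = Y.card
      · rw [Finset.card_sdiff_of_subset (Finset.mem_filter.1 hX').2, h, hk]
        congr 2
        omega
      · simp [hN _ _ h]
    have e2 : ∑ x ∈ Xᶜ, ∑ Y' ∈ Y.powerset, T (insert x X) Y'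
        = ((k + 1 : ℕ) : ℂ) * ∑ Y' ∈ Y.powerset, T X Y' := by
      rw [Finset.sum_comm]
      simp_rw [hT]
      rw [sum_powerset_sum_erase (T X), Finset.mul_sum]
      refine Finset.sum_congr rfl fun Y' hY' => ?_
      by_cases h : X.card = Y'.card
      · rw [Finset.card_sdiff_of_subset (Finset.mem_powerset.1 hY'), ← h, hk]
        congr 2
        omega
      · simp [hN _ _ h]
    have hne : ((k + 1 : ℕ) : ℂ) ≠ 0 := by exact_mod_cast Nat.succ_ne_zero k
    apply mul_left_cancel₀ hne
    rw [← e1, ← e2]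
    refine Finset.sum_congr rfl fun x hx => ?_
    have hc : (insert x X).card = X.card + 1 :=
      Finset.card_insert_of_notMem (Finset.mem_compl.1 hx)
    exact ih (insert x X) (by omega) (by omega)

/-- A product weight over the configurations that contain `Y`: every other site is free. -/
lemma sum_superset_prod (Y : Finset Λ) (f g : Λ → ℂ) :
    ∑ Y' with Y ⊆ Y', (∏ y ∈ Y' \ Y, f y) * ∏ y ∈ Y'ᶜ, g y = ∏ y ∈ Yᶜ, (f y + g y) := by
  rw [Finset.prod_add]
  refine Finset.sum_bij' (fun Y' _ => Y' \ Y) (fun Z _ => Z ∪ Y) ?_ ?_ ?_ ?_ ?_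
  · intro Y' h
    rw [Finset.mem_powerset]
    intro y hy
    simp only [Finset.mem_sdiff] at hy
    simp [hy.2]
  · intro Z h
    simp
  · intro Y' h
    exact Finset.sdiff_union_of_subset (Finset.mem_filter.1 h).2
  · intro Z h
    rw [Finset.mem_powerset] at h
    apply Finset.union_sdiff_cancel_right
    exact Finset.disjoint_left.2 fun y hy => Finset.mem_compl.1 (h hy)
  · intro Y' h
    have : Yᶜ \ (Y' \ Y) = Y'ᶜ := by
      have := (Finset.mem_filter.1 h).2
      ext y
      simp only [Finset.mem_sdiff, Finset.mem_compl]
      have := @this y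
      tauto
    rw [this]

/-- The duality of `sum_superset_eq_sum_powerset` with each removed particle weighted by `s`. -/
lemma sum_superset_pow {T : Finset Λ → Finset Λ → ℂ}
    (hN : ∀ X Y, X.card ≠ Y.card → T X Y = 0)
    (hT : ∀ X Y, ∑ Y' with Y ⊆ Y', T X Y' = ∑ X' ∈ X.powerset, T X' Y) (s : ℂ)
    (X Y : Finset Λ) :
    ∑ Y' with Y ⊆ Y', s ^ (Y' \ Y).card * T X Y'
      = ∑ X' ∈ X.powerset, s ^ (X \ X').card * T X' Y := by
  trans s ^ (X.card - Y.card) * ∑ Y' with Y ⊆ Y', T X Y'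
  · rw [Finset.mul_sum]
    refine Finset.sum_congr rfl fun Y' hY' => ?_
    by_cases h : X.card = Y'.card
    · rw [Finset.card_sdiff_of_subset (Finset.mem_filter.1 hY').2, h]
    · simp [hN _ _ h]
  · rw [hT, Finset.mul_sum]
    refine Finset.sum_congr rfl fun X' hX' => ?_
    by_cases h : X'.card = Y.card
    · rw [Finset.card_sdiff_of_subset (Finset.mem_powerset.1 hX'), h]
    · simp [hN _ _ h]

/-- A product weight `1 + α` on the final configuration, expanded with the first duality. -/
lemma sum_prod_one_add_mul {T : Finset Λ → Finset Λ → ℂ}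
    (hT : ∀ X Y, ∑ X' with X ⊆ X', T X' Y = ∑ Y' ∈ Y.powerset, T X Y') (α : Λ → ℂ)
    (Y : Finset Λ) :
    ∑ X, (∏ x ∈ X, (1 + α x)) * T X Y
      = ∑ X, (∏ x ∈ X, α x) * ∑ Y' ∈ Y.powerset, T X Y' := by
  simp_rw [Finset.prod_one_add, ← hT, Finset.sum_mul, Finset.mul_sum]
  exact Finset.sum_comm' (by simp)

/-- A product weight `β + s` on the initial configuration, expanded with the second duality. -/
lemma sum_prod_add_mul {T : Finset Λ → Finset Λ → ℂ}
    (hN : ∀ X Y, X.card ≠ Y.card → T X Y = 0)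
    (hT : ∀ X Y, ∑ Y' with Y ⊆ Y', T X Y' = ∑ X' ∈ X.powerset, T X' Y) (s : ℂ) (β : Λ → ℂ)
    (X : Finset Λ) :
    ∑ Y, (∏ y ∈ Y, (β y + s)) * T X Y
      = ∑ Y, (∏ y ∈ Y, β y) * ∑ X' ∈ X.powerset, s ^ (X \ X').card * T X' Y := by
  simp_rw [Finset.prod_add, Finset.prod_const, ← sum_superset_pow hN hT, Finset.sum_mul,
    Finset.mul_sum, mul_assoc]
  exact Finset.sum_comm' (by simp)

/-- The generating function of a self-dual kernel for a step initial product measure, when the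
total weight `κ` of a right site does not vanish. The first duality removes the particles of `X` on
the left, the second one those of `Y` on the right; a crossing pair keeps the weight `ω` per
particle. -/
lemma sum_prod_eq_of_ne_zero {T : Finset Λ → Finset Λ → ℂ}
    (hN : ∀ X Y, X.card ≠ Y.card → T X Y = 0)
    (hT1 : ∀ X Y, ∑ X' with X ⊆ X', T X' Y = ∑ Y' ∈ Y.powerset, T X Y')
    (hT2 : ∀ X Y, ∑ Y' with Y ⊆ Y', T X Y' = ∑ X' ∈ X.powerset, T X' Y)
    (R : Finset Λ) {u v a b : ℂ} (huv : u * v = 1) (hκ : b * v + (1 - b) ≠ 0) :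
    ∑ Y, ((∏ y ∈ Y, if y ∈ R then b * v else a) * ∏ y ∈ Yᶜ, if y ∈ R then 1 - b else 1 - a)
        * ∑ X, (∏ x ∈ X, if x ∈ R then u else 1) * T X Y
      = ∑ Y ∈ Rᶜ.powerset, ∑ X ∈ R.powerset,
          (a * (u - 1) + b * (v - 1) + a * b * (u - 1) * (v - 1)) ^ X.card * T X Y := by
  -- the initial weight per site is `κ s` on an occupied right site, and `κ` in total; `β` is what
  -- remains of the relative weight of an occupied site once `s` is split off
  set κ := b * v + (1 - b) with hκd
  set i : Λ → ℂ := fun y => if y ∈ R then b * v else a with hi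
  set o : Λ → ℂ := fun y => if y ∈ R then 1 - b else 1 - a with ho
  set s : ℂ := b * v / κ with hs
  have hsκ : s * κ = b * v := div_mul_cancel₀ _ hκ
  set α : Λ → ℂ := fun x => if x ∈ R then u - 1 else 0 with hα
  set β : Λ → ℂ := fun y => if y ∈ R then 0 else a - s with hβ
  have hu : ∀ X : Finset Λ, (∏ x ∈ X, if x ∈ R then u else 1) = ∏ x ∈ X, (1 + α x) := fun X =>
    Finset.prod_congr rfl fun x _ => by simp only [hα]; split_ifs <;> ring
  simp_rw [hu, sum_prod_one_add_mul hT1]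
  have hio : ∀ y, i y = (i y + o y) * (β y + s) := fun y => by
    simp only [hi, ho, hβ]
    split_ifs
    · rw [← hκd]; linear_combination -hsκ
    · ring
  have htot : ∀ Z : Finset Λ, ∏ y ∈ Z, (i y + o y) = κ ^ (R ∩ Z).card := fun Z => by
    have : ∀ y, i y + o y = if y ∈ R then κ else 1 := fun y => by
      simp only [hi, ho]
      split_ifs
      · exact hκd.symm
      · ring
    rw [Finset.prod_congr rfl fun y _ => this y, Finset.prod_ite, Finset.prod_const,
      Finset.prod_const_one, mul_one, Finset.filter_mem_eq_inter, Finset.inter_comm]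
  have hP : ∀ Y, ∑ Y' with Y ⊆ Y', (∏ y ∈ Y', i y) * ∏ y ∈ Y'ᶜ, o y
      = κ ^ R.card * ∏ y ∈ Y, (β y + s) := fun Y => by
    have : ∀ Y' ∈ Finset.univ.filter (fun Y' => Y ⊆ Y'), (∏ y ∈ Y', i y) * ∏ y ∈ Y'ᶜ, o y
        = (∏ y ∈ Y, i y) * ((∏ y ∈ Y' \ Y, i y) * ∏ y ∈ Y'ᶜ, o y) := fun Y' h => by
      rw [← Finset.prod_sdiff (Finset.mem_filter.1 h).2]; ring
    rw [Finset.sum_congr rfl this, ← Finset.mul_sum, sum_superset_prod,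
      Finset.prod_congr rfl (fun y _ => hio y), Finset.prod_mul_distrib, mul_right_comm,
      Finset.prod_mul_prod_compl, htot, Finset.inter_univ]
  have hQ : ∀ X, ∑ X' with X ⊆ X', (∏ x ∈ X', α x) * s ^ (X' \ X).card
      = (∏ x ∈ X, α x) * ∏ x ∈ Xᶜ, (1 + α x * s) := fun X => by
    have : ∀ X' ∈ Finset.univ.filter (fun X' => X ⊆ X'),
        (∏ x ∈ X', α x) * s ^ (X' \ X).card
        = (∏ x ∈ X, α x) * ((∏ x ∈ X' \ X, α x * s) * ∏ x ∈ X'ᶜ, 1) := fun X' h => by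
      rw [← Finset.prod_sdiff (Finset.mem_filter.1 h).2, Finset.prod_mul_distrib,
        Finset.prod_const, Finset.prod_const_one]
      ring
    rw [Finset.sum_congr rfl this, ← Finset.mul_sum, sum_superset_prod]
    exact congrArg _ (Finset.prod_congr rfl fun x _ => add_comm _ _)
  -- `α` is supported on `R` and `β` off `R`, so only crossing pairs survive the two expansions
  calc ∑ Y, ((∏ y ∈ Y, i y) * ∏ y ∈ Yᶜ, o y)
        * ∑ X, (∏ x ∈ X, α x) * ∑ Y' ∈ Y.powerset, T X Y'
      = ∑ X, (∏ x ∈ X, α x) * ∑ Y, ((∏ y ∈ Y, i y) * ∏ y ∈ Yᶜ, o y)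
          * ∑ Y' ∈ Y.powerset, T X Y' := by
        simp_rw [Finset.mul_sum]
        rw [Finset.sum_comm]
        refine Finset.sum_congr rfl fun X _ => Finset.sum_congr rfl fun Y _ =>
          Finset.sum_congr rfl fun Z _ => ?_
        ring
    _ = ∑ X, (∏ x ∈ X, α x) * ∑ Y, (κ ^ R.card * ∏ y ∈ Y, (β y + s)) * T X Y := by
        refine Finset.sum_congr rfl fun X _ => ?_
        congr 1
        simp_rw [← hP, Finset.sum_mul, Finset.mul_sum]
        exact Finset.sum_comm' (by simp)
    _ = κ ^ R.card * ∑ X, (∏ x ∈ X, α x) * ∑ Y, (∏ y ∈ Y, β y)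
          * ∑ X' ∈ X.powerset, s ^ (X \ X').card * T X' Y := by
        simp_rw [← sum_prod_add_mul hN hT2, Finset.mul_sum]
        refine Finset.sum_congr rfl fun X _ => Finset.sum_congr rfl fun Y _ => ?_
        ring
    _ = κ ^ R.card * ∑ Y, (∏ y ∈ Y, β y) * ∑ X, (∑ X' with X ⊆ X',
          (∏ x ∈ X', α x) * s ^ (X' \ X).card) * T X Y := by
        congr 1
        simp_rw [Finset.mul_sum, Finset.sum_mul]
        rw [Finset.sum_comm]
        refine Finset.sum_congr rfl fun Y _ => ?_
        rw [Finset.sum_comm' (t' := Finset.univ)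
          (s' := fun X' => Finset.univ.filter fun X => X' ⊆ X) (by simp)]
        refine Finset.sum_congr rfl fun X _ => ?_
        rw [Finset.mul_sum]
        refine Finset.sum_congr rfl fun X' _ => ?_
        ring
    _ = _ := by
        simp_rw [hQ]
        rw [Finset.mul_sum, ← Finset.sum_subset (Finset.subset_univ Rᶜ.powerset)]
        · refine Finset.sum_congr rfl fun Y hY => ?_
          rw [Finset.mul_sum, Finset.mul_sum,
            ← Finset.sum_subset (Finset.subset_univ R.powerset)]
          · refine Finset.sum_congr rfl fun X hX => ?_
            by_cases hc : X.card = Y.card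
            swap
            · simp [hN _ _ hc]
            rw [Finset.mem_powerset] at hX hY
            have e1 : ∏ x ∈ X, α x = (u - 1) ^ X.card := by
              rw [← Finset.prod_const]
              exact Finset.prod_congr rfl fun x hx => if_pos (hX hx)
            have e2 : ∏ y ∈ Y, β y = (a - s) ^ X.card := by
              rw [hc, ← Finset.prod_const]
              exact Finset.prod_congr rfl fun y hy => if_neg (Finset.mem_compl.1 (hY hy))
            have hone : ∀ x, (1 + α x * s) * (i x + o x) = 1 := fun x => by
              simp only [hα, hi, ho]
              split_ifs
              · linear_combination (u - 1) * hsκ + b * huv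
              · ring
            have e3 : κ ^ R.card * ∏ x ∈ Xᶜ, (1 + α x * s) = κ ^ X.card := by
              have : (∏ x ∈ Xᶜ, (i x + o x)) * ∏ x ∈ Xᶜ, (1 + α x * s) = 1 := by
                rw [← Finset.prod_mul_distrib]
                exact Finset.prod_eq_one fun x _ => by rw [mul_comm]; exact hone x
              rw [← Finset.inter_univ R, ← htot, ← Finset.prod_mul_prod_compl X, mul_assoc, this,
                mul_one, htot, Finset.inter_eq_right.2 hX]
            have hω : a * (u - 1) + b * (v - 1) + a * b * (u - 1) * (v - 1)
                = (u - 1) * (a - s) * κ := by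
              linear_combination (u - 1) * hsκ + b * huv
            rw [e1, e2, hω, mul_pow, mul_pow, ← e3]
            ring
          · intro X _ hX
            rw [Finset.mem_powerset, Finset.not_subset] at hX
            obtain ⟨x, hx, hxR⟩ := hX
            have : ∏ x ∈ X, α x = 0 := Finset.prod_eq_zero hx (if_neg hxR)
            simp [this]
        · intro Y _ hY
          rw [Finset.mem_powerset, Finset.not_subset] at hY
          obtain ⟨y, hy, hyR⟩ := hY
          have : ∏ y ∈ Y, β y = 0 :=
            Finset.prod_eq_zero hy (if_pos (by simpa using hyR))
          simp [this]

/-- The generating function of a self-dual kernel for a step initial product measure depends on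
the two densities and the counting field only through `ω`. -/
lemma sum_prod_eq {T : Finset Λ → Finset Λ → ℂ}
    (hN : ∀ X Y, X.card ≠ Y.card → T X Y = 0)
    (hT1 : ∀ X Y, ∑ X' with X ⊆ X', T X' Y = ∑ Y' ∈ Y.powerset, T X Y')
    (hT2 : ∀ X Y, ∑ Y' with Y ⊆ Y', T X Y' = ∑ X' ∈ X.powerset, T X' Y)
    (R : Finset Λ) {u v : ℂ} (huv : u * v = 1) (a b : ℂ) :
    ∑ Y, ((∏ y ∈ Y, if y ∈ R then b * v else a) * ∏ y ∈ Yᶜ, if y ∈ R then 1 - b else 1 - a)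
        * ∑ X, (∏ x ∈ X, if x ∈ R then u else 1) * T X Y
      = ∑ Y ∈ Rᶜ.powerset, ∑ X ∈ R.powerset,
          (a * (u - 1) + b * (v - 1) + a * b * (u - 1) * (v - 1)) ^ X.card * T X Y := by
  -- both sides are continuous in `b`, and `κ` vanishes at most at `b = 1 / (1 - v)`
  have hd : Dense {b : ℂ | b * v + (1 - b) ≠ 0} := by
    refine (dense_compl_singleton (1 / (1 - v) : ℂ)).mono fun c hc => ?_
    rw [Set.mem_compl_singleton_iff] at hc
    refine fun h0 => hc ?_
    have h1 : c * (1 - v) = 1 := by linear_combination -h0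
    exact eq_one_div_of_mul_eq_one_left h1
  refine congrFun (Continuous.ext_on hd ?_ ?_
    (fun c hc => sum_prod_eq_of_ne_zero (a := a) hN hT1 hT2 R huv hc)) b
  · refine continuous_finsetSum _ fun Y _ => Continuous.mul (Continuous.mul ?_ ?_) (by fun_prop)
    all_goals
      refine continuous_finsetProd _ fun y _ => ?_
      split_ifs <;> fun_prop
  · fun_prop

end Duality

/-! ### Sign-free hopping on sets of integers -/

section Hops
variable {S : Set ℤ}

/-- A configuration on `S` as a set of integers. -/
def sites (X : Finset S) : Finset ℤ := X.map (Function.Embedding.subtype (· ∈ S))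

lemma sites_injective : Function.Injective (sites : Finset S → Finset ℤ) :=
  Finset.map_injective _

@[simp] lemma mem_sites {X : Finset S} {x : S} : (x : ℤ) ∈ sites X ↔ x ∈ X := by
  simp [sites]

lemma mem_sites_iff {X : Finset S} {x : ℤ} : x ∈ sites X ↔ ∃ h : x ∈ S, (⟨x, h⟩ : S) ∈ X := by
  simp [sites]

lemma mem_of_mem_sites {X : Finset S} {x : ℤ} (h : x ∈ sites X) : x ∈ S :=
  (mem_sites_iff.1 h).1

@[simp] lemma card_sites (X : Finset S) : (sites X).card = X.card := Finset.card_map _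

lemma sites_insert (x : S) (X : Finset S) : sites (insert x X) = insert (x : ℤ) (sites X) := by
  simp [sites, Finset.map_insert]

lemma sites_erase (x : S) (X : Finset S) : sites (X.erase x) = (sites X).erase (x : ℤ) := by
  simp [sites, Finset.map_erase]

lemma sites_symmDiff (X Y : Finset S) : sites (symmDiff X Y) = symmDiff (sites X) (sites Y) := by
  ext x
  by_cases h : x ∈ S
  · simp [mem_sites_iff, Finset.mem_symmDiff, h]
  · simp [mem_sites_iff, Finset.mem_symmDiff, h]

lemma exists_sites_eq {W : Finset ℤ} (h : ∀ x ∈ W, x ∈ S) : ∃ X : Finset S, sites X = W := by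
  classical
  exact ⟨W.subtype (· ∈ S), Finset.subtype_map_of_mem h⟩

/-- Hopping between adjacent sites carries no fermionic sign. -/
lemma opMul_create_annih_apply {c d : S} (hcd : (d : ℤ) = c + 1 ∨ (c : ℤ) = d + 1)
    (X Z : Finset S) :
    opMul (create c) (annih d) X Z = if (c : ℤ) ∈ sites X ∧ (d : ℤ) ∉ sites X ∧
      sites Z = insert (d : ℤ) ((sites X).erase c) then 1 else 0 := by
  have hne : c ≠ d := by rintro rfl; omega
  simp only [← sites_erase, ← sites_insert, sites_injective.eq_iff, mem_sites]
  rw [opMul, finsum_eq_single _ (X.erase c)]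
  · rw [create_apply', annih_apply]
    by_cases hc : c ∈ X
    · have hd : d ∉ X.erase c ↔ d ∉ X := by simp [hne.symm]
      simp only [hc, true_and, if_true, hd]
      split_ifs with h
      · have hs : jwSign (X.erase c) c = jwSign (X.erase c) d := by
          unfold jwSign
          congr 2
          refine Finset.filter_congr fun y hy => ?_
          have h1 : y ≠ c := Finset.ne_of_mem_erase hy
          have h2 : y ≠ d := by rintro rfl; exact h.1 (Finset.mem_of_mem_erase hy)
          have h1' : (y : ℤ) ≠ c := fun e => h1 (Subtype.ext e)
          have h2' : (y : ℤ) ≠ d := fun e => h2 (Subtype.ext e)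
          rw [← Subtype.coe_lt_coe, ← Subtype.coe_lt_coe]
          omega
        rw [hs, jwSign_mul_self]
      · simp
    · simp [hc]
  · intro W hW
    rw [create_apply', if_neg (fun h => hW h.2), zero_mul]

lemma opMul_create_annih_symm (c d : S) (X Z : Finset S) :
    opMul (create c) (annih d) X Z = opMul (create d) (annih c) Z X := by
  have h : ∀ (x : S) (A B : Finset S), annih x A B = create x B A := fun x A B => by
    rw [annih_apply, create_apply]
  simp_rw [opMul, h]
  exact finsum_congr fun W => mul_comm _ _

open Classical in
/-- The sum of a function `v` over all configurations that arise from `X` by moving one particle to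
an adjacent empty site of `S`. -/
def hopSum (S : Set ℤ) (v : Finset ℤ → ℂ) (X : Finset ℤ) : ℂ :=
  ∑ e ∈ ({1, -1} : Finset ℤ), ∑ x ∈ X,
    if x + e ∈ S ∧ x + e ∉ X then v (insert (x + e) (X.erase x)) else 0

lemma finsum_comp_injective {ι : Type*} {g : ι → ℤ} (hg : Function.Injective g) {F : ℤ → ℂ}
    {s : Finset ℤ} (h1 : ∀ x, F x ≠ 0 → x ∈ s) (h2 : ∀ x, F x ≠ 0 → x ∈ Set.range g) :
    (Function.support fun i => F (g i)).Finite ∧ ∑ᶠ i, F (g i) = ∑ x ∈ s, F x := by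
  constructor
  · exact (s.finite_toSet.subset h1).preimage hg.injOn
  · rw [← finsum_mem_range (f := F) hg]
    refine finsum_mem_eq_sum_of_inter_support_eq F ?_
    ext x
    have := h1 x
    have := h2 x
    simp only [Set.mem_inter_iff, Function.mem_support, Finset.mem_coe]
    tauto

open Classical in
/-- A matrix element of the Hamiltonian is `-1` for two configurations that differ by one hop, and
`0` otherwise. -/
lemma hamiltonian_apply (X Z : Finset S) :
    hamiltonian S X Z = -∑ e ∈ ({1, -1} : Finset ℤ), ∑ x ∈ sites X,
      if (x + e ∈ S ∧ x + e ∉ sites X) ∧ sites Z = insert (x + e) ((sites X).erase x)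
        then 1 else 0 := by
  set F : ℤ → ℤ → ℂ := fun e x =>
    if x ∈ sites X ∧ (x + e ∈ S ∧ x + e ∉ sites X) ∧
      sites Z = insert (x + e) ((sites X).erase x) then 1 else 0 with hF
  have hF1 : ∀ e x, F e x ≠ 0 → x ∈ sites X ∧ x + e ∈ S := fun e x h => by
    by_contra hc
    exact h (if_neg (by tauto))
  have hsum : ∀ e, ∑ x ∈ sites X, F e x = ∑ x ∈ sites X,
      if (x + e ∈ S ∧ x + e ∉ sites X) ∧ sites Z = insert (x + e) ((sites X).erase x)
        then 1 else 0 := fun e => Finset.sum_congr rfl fun x hx => by simp only [hF, hx, true_and]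
  have hR : ∀ b : {b : S × S // (b.2 : ℤ) = b.1 + 1},
      opMul (create b.1.1) (annih b.1.2) X Z = F 1 b.1.1 := fun b => by
    have hS : (b.1.1 : ℤ) + 1 ∈ S := by rw [← b.2]; exact b.1.2.2
    rw [opMul_create_annih_apply (Or.inl b.2)]
    simp only [hF, hS, true_and, b.2]
  have hL : ∀ b : {b : S × S // (b.2 : ℤ) = b.1 + 1},
      opMul (create b.1.2) (annih b.1.1) X Z = F (-1) b.1.2 := fun b => by
    have he : (b.1.1 : ℤ) = b.1.2 + -1 := by rw [b.2]; ring
    have hS : (b.1.2 : ℤ) + -1 ∈ S := by rw [← he]; exact b.1.1.2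
    rw [opMul_create_annih_apply (Or.inr b.2)]
    simp only [hF, hS, true_and, he]
  have hiR : Function.Injective
      fun b : {b : S × S // (b.2 : ℤ) = b.1 + 1} => (b.1.1 : ℤ) := by
    intro b b' h
    have h1 := b.2
    have h2 := b'.2
    simp only at h
    refine Subtype.ext (Prod.ext (Subtype.ext h) (Subtype.ext ?_))
    omega
  have hiL : Function.Injective
      fun b : {b : S × S // (b.2 : ℤ) = b.1 + 1} => (b.1.2 : ℤ) := by
    intro b b' h
    have h1 := b.2
    have h2 := b'.2
    simp only at h
    refine Subtype.ext (Prod.ext (Subtype.ext ?_) (Subtype.ext h))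
    omega
  have kR := finsum_comp_injective hiR (F := F 1) (s := sites X) (fun x h => (hF1 _ x h).1)
    fun x h => ⟨⟨(⟨x, mem_of_mem_sites (hF1 _ x h).1⟩, ⟨x + 1, (hF1 _ x h).2⟩), rfl⟩, rfl⟩
  have kL := finsum_comp_injective hiL (F := F (-1)) (s := sites X) (fun x h => (hF1 _ x h).1)
    fun x h => ⟨⟨(⟨x + -1, (hF1 _ x h).2⟩, ⟨x, mem_of_mem_sites (hF1 _ x h).1⟩), by simp⟩, rfl⟩
  rw [hamiltonian, Finset.sum_pair (by decide), ← hsum, ← hsum, ← kR.2, ← kL.2,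
    ← finsum_add_distrib kR.1 kL.1]
  simp only [Matrix.add_apply, hR, hL]

lemma hamiltonian_symm (X Z : Finset S) : hamiltonian S X Z = hamiltonian S Z X := by
  simp only [hamiltonian, Matrix.add_apply]
  congr 1
  refine finsum_congr fun b => ?_
  rw [opMul_create_annih_symm b.1.1 b.1.2 X Z, opMul_create_annih_symm b.1.2 b.1.1 X Z, add_comm]

lemma finsum_hamiltonian_mul (v : Finset ℤ → ℂ) (X : Finset S) :
    ∑ᶠ Z, hamiltonian S X Z * v (sites Z) = -hopSum S v (sites X) := by
  classical
  have hmove : ∀ W : Finset ℤ, (Function.support fun Z : Finset S =>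
      (if sites Z = W then v (sites Z) else 0)).Finite := fun W => by
    refine Set.Subsingleton.finite fun Z hZ Z' hZ' => sites_injective ?_
    have h : ∀ Z : Finset S, (if sites Z = W then v (sites Z) else 0) ≠ 0 → sites Z = W :=
      fun Z h => by by_contra hc; exact h (if_neg hc)
    exact (h Z hZ).trans (h Z' hZ').symm
  have hval : ∀ W : Finset ℤ, (∀ x ∈ W, x ∈ S) →
      ∑ᶠ Z : Finset S, (if sites Z = W then v (sites Z) else 0) = v W := fun W hW => by
    obtain ⟨Z, rfl⟩ := exists_sites_eq hW
    rw [finsum_eq_single _ Z fun Z' hZ' => if_neg fun e => hZ' (sites_injective e), if_pos rfl]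
  set p : ℤ → ℤ → Prop := fun e x => x + e ∈ S ∧ x + e ∉ sites X with hp
  set W : ℤ → ℤ → Finset ℤ := fun e x => insert (x + e) ((sites X).erase x) with hW
  have hterm : ∀ Z : Finset S, hamiltonian S X Z * v (sites Z)
      = -∑ e ∈ ({1, -1} : Finset ℤ), ∑ x ∈ sites X,
        if p e x then (if sites Z = W e x then v (sites Z) else 0) else 0 := fun Z => by
    rw [hamiltonian_apply, neg_mul, Finset.sum_mul]
    simp_rw [Finset.sum_mul, ite_and, ite_mul, one_mul, zero_mul]
    simp only [hp, ite_and, hW]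
  have hfin : ∀ e x, (Function.support fun Z : Finset S =>
      if p e x then (if sites Z = W e x then v (sites Z) else 0) else 0).Finite := fun e x => by
    by_cases h : p e x
    · simpa only [if_pos h] using hmove (W e x)
    · simp [h]
  simp_rw [hterm]
  rw [finsum_neg_distrib, finsum_sum_comm, hopSum]
  · congr 1
    refine Finset.sum_congr rfl fun e _ => ?_
    rw [finsum_sum_comm]
    · refine Finset.sum_congr rfl fun x _ => ?_
      by_cases h : p e x
      · simp only [if_pos h]
        rw [if_pos h, hval]
        intro y hy
        rcases Finset.mem_insert.1 hy with rfl | hy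
        · exact h.1
        · exact mem_of_mem_sites (Finset.mem_of_mem_erase hy)
      · simp only [if_neg h]
        rw [if_neg h, finsum_zero]
    · exact fun x _ => hfin e x
  · intro e _
    refine (Set.Finite.biUnion (sites X).finite_toSet fun x _ => hfin e x).subset ?_
    intro Z hZ
    obtain ⟨x, hx, hne⟩ := Finset.exists_ne_zero_of_sum_ne_zero hZ
    exact Set.mem_biUnion hx hne

/-- The Liouvillian of the lattice `S` on functions of two finite sets of integers. -/
def siteLiouvillian (S : Set ℤ) (γ : ℝ) (ρ : Finset ℤ → Finset ℤ → ℂ) :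
    Finset ℤ → Finset ℤ → ℂ := fun X Y =>
  Complex.I * (hopSum S (fun X' => ρ X' Y) X - hopSum S (ρ X) Y)
    - 2 * γ * (symmDiff X Y).card * ρ X Y

lemma liouvillian_apply_sites {γ : ℝ} (hγ : 0 ≤ γ) {ρ : Op S} {σ : Finset ℤ → Finset ℤ → ℂ}
    (h : ∀ X Y, ρ X Y = σ (sites X) (sites Y)) (X Y : Finset S) :
    liouvillian γ ρ X Y = siteLiouvillian S γ σ (sites X) (sites Y) := by
  have h1 : opMul (hamiltonian S) ρ X Y = -hopSum S (fun X' => σ X' (sites Y)) (sites X) := by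
    rw [opMul, ← finsum_hamiltonian_mul]
    simp_rw [h]
  have h2 : opMul ρ (hamiltonian S) X Y = -hopSum S (σ (sites X)) (sites Y) := by
    rw [opMul, ← finsum_hamiltonian_mul]
    simp_rw [h, hamiltonian_symm _ Y, mul_comm]
  rw [liouvillian, finsum_dissipator hγ, Matrix.sub_apply, h1, h2, siteLiouvillian,
    ← sites_symmDiff, card_sites, h]
  ring

/-- The matrix elements of `|A⟩⟨A|`. -/
def siteKetBra (A X Y : Finset ℤ) : ℂ := if X = A ∧ Y = A then 1 else 0

/-- The terms of the exponential series on functions of two finite sets of integers. -/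
def siteTerm (S : Set ℤ) (γ t : ℝ) (A X Y : Finset ℤ) (k : ℕ) : ℂ :=
  ((t : ℂ) ^ k / (k.factorial : ℂ)) * ((siteLiouvillian S γ)^[k] (siteKetBra A)) X Y

lemma evolveTerm_ketBra {γ : ℝ} (hγ : 0 ≤ γ) (t : ℝ) (A X Y : Finset S) (k : ℕ) :
    evolveTerm γ t (ketBra A) X Y k = siteTerm S γ t (sites A) (sites X) (sites Y) k := by
  have key : ∀ k (X Y : Finset S), ((liouvillian γ)^[k] (ketBra A)) X Y
      = ((siteLiouvillian S γ)^[k] (siteKetBra (sites A))) (sites X) (sites Y) := fun k => by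
    induction k with
    | zero =>
      intro X Y
      simp only [Function.iterate_zero, id, ketBra, siteKetBra, Matrix.single_apply,
        sites_injective.eq_iff, eq_comm]
    | succ k ih =>
      intro X Y
      rw [Function.iterate_succ_apply', Function.iterate_succ_apply',
        liouvillian_apply_sites hγ ih]
  rw [evolveTerm, siteTerm, key]

end Hops

/-! ### Exponential localization -/

section Bounds

/-- The weight `∏_{x ∈ X} 2^{-x}`, which grows at most by a factor `2` under a hop. It suppresses
particles far to the right, and its inverse particles far to the left. -/
def tilt (X : Finset ℤ) : ℝ := ∏ x ∈ X, (2 : ℝ) ^ (-x)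

lemma tilt_pos (X : Finset ℤ) : 0 < tilt X := Finset.prod_pos fun x _ => by positivity

lemma tilt_hop_le {X : Finset ℤ} {x e : ℤ} (hx : x ∈ X) (he : e ∈ ({1, -1} : Finset ℤ))
    (hxe : x + e ∉ X) : tilt (insert (x + e) (X.erase x)) ≤ 2 * tilt X := by
  have hne : x + e ∉ X.erase x := fun h => hxe (Finset.mem_of_mem_erase h)
  rw [tilt, Finset.prod_insert hne, tilt, ← Finset.mul_prod_erase X _ hx, ← mul_assoc]
  refine mul_le_mul_of_nonneg_right ?_ (Finset.prod_nonneg fun y _ => by positivity)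
  rw [← zpow_one_add₀ (two_ne_zero)]
  refine zpow_le_zpow_right₀ one_le_two ?_
  simp only [Finset.mem_insert, Finset.mem_singleton] at he
  omega

lemma card_hop {X : Finset ℤ} {x y : ℤ} (hx : x ∈ X) (hy : y ∉ X) :
    (insert y (X.erase x)).card = X.card := by
  rw [Finset.card_insert_of_notMem fun h => hy (Finset.mem_of_mem_erase h),
    Finset.card_erase_add_one hx]

lemma norm_hopSum_le {S : Set ℤ} {v : Finset ℤ → ℂ} {X : Finset ℤ} {C : ℝ} (hC : 0 ≤ C)
    (h : ∀ W : Finset ℤ, W.card = X.card → ‖v W‖ ≤ C * tilt W) :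
    ‖hopSum S v X‖ ≤ 4 * X.card * (C * tilt X) := by
  classical
  have hterm : ∀ e ∈ ({1, -1} : Finset ℤ), ∀ x ∈ X,
      ‖if x + e ∈ S ∧ x + e ∉ X then v (insert (x + e) (X.erase x)) else 0‖
        ≤ 2 * (C * tilt X) := fun e he x hx => by
    split_ifs with hc
    · refine (h _ (card_hop hx hc.2)).trans ?_
      have := mul_le_mul_of_nonneg_left (tilt_hop_le hx he hc.2) hC
      linarith
    · rw [norm_zero]
      have := tilt_pos X
      positivity
  calc ‖hopSum S v X‖
      ≤ ∑ e ∈ ({1, -1} : Finset ℤ), ∑ _x ∈ X, 2 * (C * tilt X) := by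
        refine (norm_sum_le _ _).trans (Finset.sum_le_sum fun e he => ?_)
        refine (norm_sum_le _ _).trans (Finset.sum_le_sum fun x hx => ?_)
        -- the decidability instances of the two conditions differ
        convert hterm e he x hx
    _ = 4 * X.card * (C * tilt X) := by
        rw [Finset.sum_const, Finset.sum_const, nsmul_eq_mul, nsmul_eq_mul,
          show ({1, -1} : Finset ℤ).card = 2 from by decide]
        push_cast
        ring

lemma hopSum_eq_zero {S : Set ℤ} {v : Finset ℤ → ℂ} {X : Finset ℤ}
    (h : ∀ W : Finset ℤ, W.card = X.card → v W = 0) : hopSum S v X = 0 := by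
  classical
  refine Finset.sum_eq_zero fun e _ => Finset.sum_eq_zero fun x hx => ?_
  split_ifs with hc
  · exact h _ (card_hop hx hc.2)
  · rfl

lemma siteLiouvillian_eq_zero {S : Set ℤ} {γ : ℝ} {ρ : Finset ℤ → Finset ℤ → ℂ} {n : ℕ}
    (h : ∀ X Y : Finset ℤ, ¬(X.card = n ∧ Y.card = n) → ρ X Y = 0) (X Y : Finset ℤ)
    (hXY : ¬(X.card = n ∧ Y.card = n)) : siteLiouvillian S γ ρ X Y = 0 := by
  rw [siteLiouvillian, hopSum_eq_zero fun W hW => h W Y (by rwa [hW]),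
    hopSum_eq_zero fun W hW => h X W (by rwa [hW]), h X Y hXY]
  simp

/-- The iterates of the Liouvillian conserve the number of particles. -/
lemma iterate_siteLiouvillian_eq_zero {S : Set ℤ} {γ : ℝ} {A : Finset ℤ} (k : ℕ)
    (X Y : Finset ℤ) (hXY : ¬(X.card = A.card ∧ Y.card = A.card)) :
    ((siteLiouvillian S γ)^[k] (siteKetBra A)) X Y = 0 := by
  induction k generalizing X Y with
  | zero =>
    refine if_neg fun h => hXY ?_
    rw [h.1, h.2]
    exact ⟨rfl, rfl⟩
  | succ k ih =>
    rw [Function.iterate_succ_apply']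
    exact siteLiouvillian_eq_zero ih X Y hXY

lemma card_symmDiff_le (X Y : Finset ℤ) : (symmDiff X Y).card ≤ X.card + Y.card := by
  refine (Finset.card_le_card (t := X ∪ Y) ?_).trans (Finset.card_union_le X Y)
  intro x hx
  rw [Finset.mem_symmDiff] at hx
  rw [Finset.mem_union]
  tauto

lemma norm_siteLiouvillian_le {S : Set ℤ} {γ : ℝ} (hγ : 0 ≤ γ) {ρ : Finset ℤ → Finset ℤ → ℂ}
    {n : ℕ} {C : ℝ} (hC : 0 ≤ C)
    (h : ∀ X Y : Finset ℤ, X.card = n → Y.card = n → ‖ρ X Y‖ ≤ C * (tilt X * tilt Y))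
    {X Y : Finset ℤ} (hX : X.card = n) (hY : Y.card = n) :
    ‖siteLiouvillian S γ ρ X Y‖ ≤ ((8 + 4 * γ) * n * C) * (tilt X * tilt Y) := by
  have hXp := tilt_pos X
  have hYp := tilt_pos Y
  have h1 : ‖hopSum S (fun X' => ρ X' Y) X‖ ≤ 4 * X.card * (C * tilt Y * tilt X) :=
    norm_hopSum_le (by positivity) fun W hW => by
      have := h W Y (hW.trans hX) hY
      linarith
  have h2 : ‖hopSum S (ρ X) Y‖ ≤ 4 * Y.card * (C * tilt X * tilt Y) :=
    norm_hopSum_le (by positivity) fun W hW => by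
      have := h X W hX (hW.trans hY)
      linarith
  have h3 : ‖2 * (γ : ℂ) * (symmDiff X Y).card * ρ X Y‖
      ≤ 2 * γ * (2 * n) * (C * (tilt X * tilt Y)) := by
    rw [norm_mul, norm_mul, norm_mul, Complex.norm_natCast, Complex.norm_real,
      Real.norm_of_nonneg hγ, Complex.norm_ofNat]
    have hc : ((symmDiff X Y).card : ℝ) ≤ 2 * n := by
      have := card_symmDiff_le X Y
      rw [hX, hY] at this
      have h' : ((symmDiff X Y).card : ℝ) ≤ n + n := by exact_mod_cast this
      linarith
    have := h X Y hX hY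
    gcongr
  rw [hX] at h1
  rw [hY] at h2
  rw [siteLiouvillian]
  refine (norm_sub_le _ _).trans ?_
  rw [norm_mul, Complex.norm_I, one_mul]
  have h4 := norm_sub_le (hopSum S (fun X' => ρ X' Y) X) (hopSum S (ρ X) Y)
  calc _ ≤ (4 * n * (C * tilt Y * tilt X) + 4 * n * (C * tilt X * tilt Y))
        + 2 * γ * (2 * n) * (C * (tilt X * tilt Y)) := by linarith
    _ = _ := by ring

/-- Exponential localization: the iterates of the Liouvillian are bounded by tilted weights, in
which each application costs at most a factor proportional to the number of particles. -/
lemma norm_iterate_siteLiouvillian_le (S : Set ℤ) {γ : ℝ} (hγ : 0 ≤ γ) (A : Finset ℤ) (k : ℕ)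
    {X Y : Finset ℤ} (hX : X.card = A.card) (hY : Y.card = A.card) :
    ‖((siteLiouvillian S γ)^[k] (siteKetBra A)) X Y‖
      ≤ ((8 + 4 * γ) * A.card) ^ k * (tilt A ^ 2)⁻¹ * (tilt X * tilt Y) := by
  induction k generalizing X Y with
  | zero =>
    have hA := tilt_pos A
    rw [Function.iterate_zero, id, siteKetBra, pow_zero, one_mul]
    split_ifs with h
    · rw [h.1, h.2, norm_one, ← pow_two, inv_mul_cancel₀ (by positivity)]
    · rw [norm_zero]
      have := tilt_pos X
      have := tilt_pos Y
      positivity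
  | succ k ih =>
    rw [Function.iterate_succ_apply']
    have hA := tilt_pos A
    refine (norm_siteLiouvillian_le hγ (by positivity) (fun X Y hX hY => ih hX hY) hX hY).trans
      (le_of_eq ?_)
    ring

lemma norm_siteTerm_le (S : Set ℤ) {γ t : ℝ} (hγ : 0 ≤ γ) (ht : 0 ≤ t) (A X Y : Finset ℤ)
    (k : ℕ) : ‖siteTerm S γ t A X Y k‖
      ≤ (t * ((8 + 4 * γ) * A.card)) ^ k / k.factorial
        * ((tilt A ^ 2)⁻¹ * (tilt X * tilt Y)) := by
  have hA := tilt_pos A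
  have hX := tilt_pos X
  have hY := tilt_pos Y
  by_cases h : X.card = A.card ∧ Y.card = A.card
  · rw [siteTerm, norm_mul, norm_div, norm_pow, Complex.norm_real, Real.norm_of_nonneg ht,
      Complex.norm_natCast]
    refine (mul_le_mul_of_nonneg_left (norm_iterate_siteLiouvillian_le S hγ A k h.1 h.2)
      (by positivity)).trans (le_of_eq ?_)
    generalize (8 + 4 * γ) * (A.card : ℝ) = c
    rw [mul_pow]
    ring
  · rw [siteTerm, iterate_siteLiouvillian_eq_zero k X Y h, mul_zero, norm_zero]
    positivity

lemma hasSum_bound (c K : ℝ) :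
    HasSum (fun k : ℕ => c ^ k / k.factorial * K) (Real.exp c * K) := by
  refine HasSum.mul_right K ?_
  rw [Real.exp_eq_exp_ℝ]
  exact NormedSpace.expSeries_div_hasSum_exp c

lemma summable_siteTerm (S : Set ℤ) {γ t : ℝ} (hγ : 0 ≤ γ) (ht : 0 ≤ t) (A X Y : Finset ℤ) :
    Summable (siteTerm S γ t A X Y) :=
  Summable.of_norm_bounded (hasSum_bound _ _).summable (norm_siteTerm_le S hγ ht A X Y)

/-- The transition weight `⟨X| e^{𝓛 t}[|A⟩⟨A|] |X⟩` on the lattice `S`, for sets of integers. -/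
def siteTransition (S : Set ℤ) (γ t : ℝ) (X A : Finset ℤ) : ℂ := ∑' k, siteTerm S γ t A X X k

lemma norm_siteTransition_le (S : Set ℤ) {γ t : ℝ} (hγ : 0 ≤ γ) (ht : 0 ≤ t)
    (X A : Finset ℤ) : ‖siteTransition S γ t X A‖
      ≤ Real.exp (t * ((8 + 4 * γ) * A.card)) * ((tilt A ^ 2)⁻¹ * tilt X ^ 2) := by
  rw [pow_two (tilt X)]
  exact tsum_of_norm_bounded (hasSum_bound _ _) (norm_siteTerm_le S hγ ht A X X)

lemma siteTransition_eq_zero (S : Set ℤ) (γ t : ℝ) {X A : Finset ℤ} (h : X.card ≠ A.card) :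
    siteTransition S γ t X A = 0 := by
  rw [siteTransition]
  refine (tsum_congr fun k => ?_).trans tsum_zero
  rw [siteTerm, iterate_siteLiouvillian_eq_zero k X X (by tauto), mul_zero]

lemma eventually_mem_box (x : ℤ) : ∀ᶠ L : ℕ in Filter.atTop, x ∈ box L := by
  filter_upwards [Filter.eventually_gt_atTop x.natAbs] with L hL
  rw [Set.mem_Ioc]
  omega

/-- Each coefficient of the exponential series is the same on all sufficiently large boxes. -/
lemma eventually_iterate_eq (γ : ℝ) (A : Finset ℤ) (k : ℕ) (X Y : Finset ℤ) :
    ∀ᶠ L : ℕ in Filter.atTop, ((siteLiouvillian (box L) γ)^[k] (siteKetBra A)) X Y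
      = ((siteLiouvillian Set.univ γ)^[k] (siteKetBra A)) X Y := by
  classical
  induction k generalizing X Y with
  | zero => exact Filter.Eventually.of_forall fun L => rfl
  | succ k ih =>
    have hop : ∀ (u : ℕ → Finset ℤ → ℂ) (v : Finset ℤ → ℂ) (Z : Finset ℤ),
        (∀ W, ∀ᶠ L in Filter.atTop, u L W = v W) →
        ∀ᶠ L : ℕ in Filter.atTop, hopSum (box L) (u L) Z = hopSum Set.univ v Z := by
      intro u v Z huv
      have : ∀ᶠ L : ℕ in Filter.atTop, ∀ e ∈ ({1, -1} : Finset ℤ), ∀ x ∈ Z, x + e ∈ box L ∧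
          u L (insert (x + e) (Z.erase x)) = v (insert (x + e) (Z.erase x)) := by
        rw [Filter.eventually_all_finset]
        intro e _
        rw [Filter.eventually_all_finset]
        intro x _
        exact (eventually_mem_box _).and (huv _)
      filter_upwards [this] with L hL
      refine Finset.sum_congr rfl fun e he => Finset.sum_congr rfl fun x hx => ?_
      have h := hL e he x hx
      simp only [h.1, Set.mem_univ, h.2]
    filter_upwards [hop _ _ X fun W => ih W Y, hop _ _ Y fun W => ih X W, ih X Y]
      with L h1 h2 h3
    rw [Function.iterate_succ_apply', Function.iterate_succ_apply', siteLiouvillian,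
      siteLiouvillian, h1, h3]
    rw [show hopSum (box L) (((siteLiouvillian (box L) γ)^[k] (siteKetBra A)) X) Y
      = hopSum Set.univ (((siteLiouvillian Set.univ γ)^[k] (siteKetBra A)) X) Y from h2]

lemma tendsto_siteTransition {γ t : ℝ} (hγ : 0 ≤ γ) (ht : 0 ≤ t) (X A : Finset ℤ) :
    Filter.Tendsto (fun L : ℕ => siteTransition (box L) γ t X A) Filter.atTop
      (nhds (siteTransition Set.univ γ t X A)) := by
  refine tendsto_tsum_of_dominated_convergence (hasSum_bound _ _).summable (fun k => ?_)
    (Filter.Eventually.of_forall fun L k => norm_siteTerm_le (box L) hγ ht A X X k)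
  refine tendsto_const_nhds.congr' ?_
  filter_upwards [eventually_iterate_eq γ A k X X] with L hL
  rw [siteTerm, siteTerm, hL]

end Bounds

/-! ### The coefficients `q_n` -/

section Coefficients

/-- The pairs `(A, X)` of `n`-particle configurations with `A ⊆ {x ≤ 0}` and `X ⊆ {x > 0}` inside
`S`. -/
def crossingSet (S : Set ℤ) (n : ℕ) : Set (Finset ℤ × Finset ℤ) :=
  {p | (p.1.card = n ∧ p.2.card = n ∧ (∀ y ∈ p.1, y ≤ 0) ∧ ∀ x ∈ p.2, 0 < x) ∧
    (∀ y ∈ p.1, y ∈ S) ∧ ∀ x ∈ p.2, x ∈ S}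

/-- The transition weight of a crossing pair, extended by zero to all pairs. -/
def siteCrossingTerm (S : Set ℤ) (γ t : ℝ) (n : ℕ) : Finset ℤ × Finset ℤ → ℂ :=
  (crossingSet S n).indicator fun p => siteTransition S γ t p.2 p.1

/-- A crossing pair on `S` as a pair of sets of integers. -/
def crossingSites {S : Set ℤ} {n : ℕ} (p : CrossingPair S n) : Finset ℤ × Finset ℤ :=
  (sites p.1.1, sites p.1.2)

lemma crossingSites_injective {S : Set ℤ} {n : ℕ} :
    Function.Injective (crossingSites : CrossingPair S n → Finset ℤ × Finset ℤ) := by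
  intro p p' h
  rw [crossingSites, crossingSites, Prod.mk.injEq] at h
  exact Subtype.ext (Prod.ext (sites_injective h.1) (sites_injective h.2))

lemma range_crossingSites {S : Set ℤ} {n : ℕ} :
    Set.range (crossingSites : CrossingPair S n → Finset ℤ × Finset ℤ) = crossingSet S n := by
  ext ⟨A, X⟩
  constructor
  · rintro ⟨p, hp⟩
    rw [crossingSites, Prod.mk.injEq] at hp
    obtain ⟨rfl, rfl⟩ := hp
    obtain ⟨h1, h2, h3, h4⟩ := p.2
    refine ⟨⟨by simpa using h1, by simpa using h2, fun y hy => ?_, fun x hx => ?_⟩,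
      fun y hy => mem_of_mem_sites hy, fun x hx => mem_of_mem_sites hx⟩
    · obtain ⟨hS, hy⟩ := mem_sites_iff.1 hy
      exact h3 _ hy
    · obtain ⟨hS, hx⟩ := mem_sites_iff.1 hx
      exact h4 _ hx
  · rintro ⟨⟨h1, h2, h3, h4⟩, hA, hX⟩
    obtain ⟨A, rfl⟩ := exists_sites_eq hA
    obtain ⟨X, rfl⟩ := exists_sites_eq hX
    exact ⟨⟨(A, X), by simpa using h1, by simpa using h2, fun y hy => h3 y (mem_sites.2 hy),
      fun x hx => h4 x (mem_sites.2 hx)⟩, rfl⟩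

lemma transition_eq_siteTransition {S : Set ℤ} {γ : ℝ} (hγ : 0 ≤ γ) (t : ℝ) (X A : Finset S) :
    evolve γ t (ketBra A) X X = siteTransition S γ t (sites X) (sites A) :=
  tsum_congr fun k => evolveTerm_ketBra hγ t A X X k

lemma crossingTerm_eq {S : Set ℤ} {γ : ℝ} (hγ : 0 ≤ γ) (t : ℝ) (n : ℕ) :
    crossingTerm S γ t n = siteCrossingTerm S γ t n ∘ crossingSites := by
  funext p
  have hp : crossingSites p ∈ crossingSet S n := by
    rw [← range_crossingSites]; exact Set.mem_range_self p
  rw [Function.comp_apply, siteCrossingTerm, Set.indicator_of_mem hp, crossingTerm,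
    transition_eq_siteTransition hγ]
  rfl

lemma support_siteCrossingTerm (S : Set ℤ) (γ t : ℝ) (n : ℕ) :
    Function.support (siteCrossingTerm S γ t n)
      ⊆ Set.range (crossingSites : CrossingPair S n → Finset ℤ × Finset ℤ) := by
  rw [range_crossingSites]
  exact Set.support_indicator_subset

lemma q_eq_tsum {S : Set ℤ} {γ : ℝ} (hγ : 0 ≤ γ) (t : ℝ) (n : ℕ) :
    q S γ t n = ∑' p, siteCrossingTerm S γ t n p := by
  rw [q, crossingTerm_eq hγ]
  exact crossingSites_injective.tsum_eq (support_siteCrossingTerm S γ t n)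

/-- A summable product bound for the transition weights of crossing pairs, with a factor `c` per
particle. -/
def crossingBound (c : ℝ) (p : Finset ℤ × Finset ℤ) : ℝ :=
  (∏ y ∈ p.1, (1 / 4 : ℝ) ^ y.natAbs) * ∏ x ∈ p.2, c * (1 / 4 : ℝ) ^ x.natAbs

lemma summable_natAbs : Summable fun x : ℤ => (1 / 4 : ℝ) ^ x.natAbs := by
  refine Summable.of_nat_of_neg ?_ ?_
  · simpa using summable_geometric_of_lt_one (by norm_num : (0 : ℝ) ≤ 1 / 4) (by norm_num)
  · simpa using summable_geometric_of_lt_one (by norm_num : (0 : ℝ) ≤ 1 / 4) (by norm_num)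

lemma summable_crossingBound {c : ℝ} (hc : 0 ≤ c) : Summable (crossingBound c) := by
  have h1 : Summable fun A : Finset ℤ => ∏ y ∈ A, (1 / 4 : ℝ) ^ y.natAbs :=
    summable_finsetProd_of_summable_nonneg (fun x => by positivity) summable_natAbs
  have h2 : Summable fun X : Finset ℤ => ∏ x ∈ X, c * (1 / 4 : ℝ) ^ x.natAbs :=
    summable_finsetProd_of_summable_nonneg (fun x => by positivity) (summable_natAbs.mul_left c)
  exact h1.mul_of_nonneg h2 (fun A => Finset.prod_nonneg fun x _ => by positivity)
    fun A => Finset.prod_nonneg fun x _ => by positivity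

lemma tilt_sq_of_pos {X : Finset ℤ} (h : ∀ x ∈ X, 0 < x) :
    tilt X ^ 2 = ∏ x ∈ X, (1 / 4 : ℝ) ^ x.natAbs := by
  rw [tilt, ← Finset.prod_pow]
  refine Finset.prod_congr rfl fun x hx => ?_
  obtain ⟨m, rfl⟩ := Int.eq_ofNat_of_zero_le (h x hx).le
  rw [zpow_neg, zpow_natCast, Int.natAbs_natCast, inv_pow, ← pow_mul, mul_comm, pow_mul,
    one_div, inv_pow]
  norm_num

lemma inv_tilt_sq_of_nonpos {A : Finset ℤ} (h : ∀ y ∈ A, y ≤ 0) :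
    (tilt A ^ 2)⁻¹ = ∏ y ∈ A, (1 / 4 : ℝ) ^ y.natAbs := by
  rw [tilt, ← Finset.prod_pow, ← Finset.prod_inv_distrib]
  refine Finset.prod_congr rfl fun y hy => ?_
  obtain ⟨m, hm⟩ := Int.exists_eq_neg_ofNat (h y hy)
  subst hm
  rw [neg_neg, Int.natAbs_neg, Int.natAbs_natCast, zpow_natCast, ← pow_mul, mul_comm, pow_mul,
    one_div, inv_pow]
  norm_num

lemma norm_siteCrossingTerm_mul_le (S : Set ℤ) {γ t M : ℝ} (hγ : 0 ≤ γ) (ht : 0 ≤ t)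
    (hM : 0 ≤ M) (n : ℕ) (p : Finset ℤ × Finset ℤ) :
    ‖siteCrossingTerm S γ t n p‖ * M ^ n
      ≤ crossingBound (M * Real.exp (t * (8 + 4 * γ))) p := by
  by_cases hp : p ∈ crossingSet S n
  · rw [siteCrossingTerm, Set.indicator_of_mem hp]
    obtain ⟨⟨h1, h2, h3, h4⟩, -⟩ := hp
    refine (mul_le_mul_of_nonneg_right (norm_siteTransition_le S hγ ht p.2 p.1)
      (by positivity)).trans (le_of_eq ?_)
    rw [tilt_sq_of_pos h4, inv_tilt_sq_of_nonpos h3, crossingBound, Finset.prod_mul_distrib,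
      Finset.prod_const, h1, h2, mul_pow, ← Real.exp_nat_mul,
      show t * ((8 + 4 * γ) * (n : ℝ)) = n * (t * (8 + 4 * γ)) by ring]
    ring
  · rw [siteCrossingTerm, Set.indicator_of_notMem hp, norm_zero, zero_mul]
    exact mul_nonneg (Finset.prod_nonneg fun x _ => by positivity)
      (Finset.prod_nonneg fun x _ => by positivity)

lemma norm_siteCrossingTerm_le (S : Set ℤ) {γ t : ℝ} (hγ : 0 ≤ γ) (ht : 0 ≤ t) (n : ℕ)
    (p : Finset ℤ × Finset ℤ) :
    ‖siteCrossingTerm S γ t n p‖ ≤ crossingBound (Real.exp (t * (8 + 4 * γ))) p := by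
  simpa using norm_siteCrossingTerm_mul_le S hγ ht zero_le_one n p

lemma summable_siteCrossingTerm (S : Set ℤ) {γ t : ℝ} (hγ : 0 ≤ γ) (ht : 0 ≤ t) (n : ℕ) :
    Summable (siteCrossingTerm S γ t n) :=
  Summable.of_norm_bounded (summable_crossingBound (Real.exp_pos _).le)
    (norm_siteCrossingTerm_le S hγ ht n)

lemma summable_crossingTerm (S : Set ℤ) {γ t : ℝ} (hγ : 0 ≤ γ) (ht : 0 ≤ t) (n : ℕ) :
    Summable (crossingTerm S γ t n) := by
  rw [crossingTerm_eq hγ]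
  exact (summable_siteCrossingTerm S hγ ht n).comp_injective crossingSites_injective

/-- The coefficients decay faster than any exponential, uniformly in the lattice. -/
lemma exists_norm_q_le {γ t M : ℝ} (hγ : 0 ≤ γ) (ht : 0 ≤ t) (hM : 0 ≤ M) :
    ∃ D : ℝ, 0 ≤ D ∧ ∀ (S : Set ℤ) (n : ℕ), ‖q S γ t n‖ * M ^ n ≤ D * (1 / 2) ^ n := by
  -- the bound for `2 M` in place of `M` leaves a geometric factor to spare
  have hs := summable_crossingBound (c := 2 * M * Real.exp (t * (8 + 4 * γ))) (by positivity)
  refine ⟨∑' p, crossingBound (2 * M * Real.exp (t * (8 + 4 * γ))) p,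
    tsum_nonneg fun p => mul_nonneg (Finset.prod_nonneg fun x _ => by positivity)
      (Finset.prod_nonneg fun x _ => by positivity), fun S n => ?_⟩
  have h1 : ‖q S γ t n‖ * (2 * M) ^ n
      ≤ ∑' p, crossingBound (2 * M * Real.exp (t * (8 + 4 * γ))) p := by
    have h2 := (summable_siteCrossingTerm S hγ ht n).norm
    rw [q_eq_tsum hγ]
    refine (mul_le_mul_of_nonneg_right (norm_tsum_le_tsum_norm h2) (by positivity)).trans ?_
    rw [← tsum_mul_right]
    exact (h2.mul_right _).tsum_le_tsum
      (fun p => norm_siteCrossingTerm_mul_le S hγ ht (by positivity) n p) hs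
  calc ‖q S γ t n‖ * M ^ n = ‖q S γ t n‖ * (2 * M) ^ n * (1 / 2) ^ n := by
        rw [mul_assoc, ← mul_pow]; congr 2; ring
    _ ≤ _ := by gcongr

lemma tendsto_q {γ t : ℝ} (hγ : 0 ≤ γ) (ht : 0 ≤ t) (n : ℕ) :
    Filter.Tendsto (fun L : ℕ => q (box L) γ t n) Filter.atTop (nhds (q Set.univ γ t n)) := by
  simp_rw [q_eq_tsum hγ]
  refine tendsto_tsum_of_dominated_convergence
    (summable_crossingBound (Real.exp_pos (t * (8 + 4 * γ))).le) (fun p => ?_)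
    (Filter.Eventually.of_forall fun L p => norm_siteCrossingTerm_le (box L) hγ ht n p)
  have h1 : ∀ᶠ L : ℕ in Filter.atTop, ∀ y ∈ p.1, y ∈ box L :=
    (Filter.eventually_all_finset p.1).2 fun y _ => eventually_mem_box y
  have h2 : ∀ᶠ L : ℕ in Filter.atTop, ∀ y ∈ p.2, y ∈ box L :=
    (Filter.eventually_all_finset p.2).2 fun y _ => eventually_mem_box y
  by_cases hp : p ∈ crossingSet Set.univ n
  · rw [siteCrossingTerm, Set.indicator_of_mem hp]
    refine (tendsto_siteTransition hγ ht p.2 p.1).congr' ?_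
    filter_upwards [h1, h2] with L hL1 hL2
    have hpL : p ∈ crossingSet (box L) n := ⟨hp.1, hL1, hL2⟩
    rw [siteCrossingTerm, Set.indicator_of_mem hpL]
  · rw [siteCrossingTerm, Set.indicator_of_notMem hp]
    refine tendsto_const_nhds.congr fun L => ?_
    rw [siteCrossingTerm, Set.indicator_of_notMem fun h => hp ⟨h.1, by simp, by simp⟩]

/-- The series `∑ q_n ω^n` converges absolutely for every `ω`. -/
lemma summable_q_mul_pow (S : Set ℤ) {γ t : ℝ} (hγ : 0 ≤ γ) (ht : 0 ≤ t) (w : ℂ) :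
    Summable fun n => q S γ t n * w ^ n := by
  obtain ⟨D, -, hD⟩ := exists_norm_q_le hγ ht (norm_nonneg w)
  refine Summable.of_norm_bounded
    ((summable_geometric_of_lt_one (by norm_num : (0 : ℝ) ≤ 1 / 2) (by norm_num)).mul_left D)
    fun n => ?_
  rw [norm_mul, norm_pow]
  exact hD S n

lemma tendsto_sum_q_mul_pow {γ t : ℝ} (hγ : 0 ≤ γ) (ht : 0 ≤ t) (w : ℂ) :
    Filter.Tendsto (fun L : ℕ => ∑ n ∈ Finset.range (L + 1), q (box L) γ t n * w ^ n)
      Filter.atTop (nhds (∑' n, q Set.univ γ t n * w ^ n)) := by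
  obtain ⟨D, hD0, hD⟩ := exists_norm_q_le hγ ht (norm_nonneg w)
  have h : ∀ L : ℕ, ∑ n ∈ Finset.range (L + 1), q (box L) γ t n * w ^ n
      = ∑' n, if n ∈ Finset.range (L + 1) then q (box L) γ t n * w ^ n else 0 := fun L => by
    rw [tsum_eq_sum (s := Finset.range (L + 1)) fun n hn => if_neg hn]
    exact Finset.sum_congr rfl fun n hn => (if_pos hn).symm
  simp_rw [h]
  refine tendsto_tsum_of_dominated_convergence
    ((summable_geometric_of_lt_one (by norm_num : (0 : ℝ) ≤ 1 / 2) (by norm_num)).mul_left D)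
    (fun n => ?_) (Filter.Eventually.of_forall fun L n => ?_)
  · refine ((tendsto_q hγ ht n).mul_const (w ^ n)).congr' ?_
    filter_upwards [Filter.eventually_ge_atTop n] with L hL
    rw [if_pos (Finset.mem_range.2 (by omega))]
  · split_ifs
    · rw [norm_mul, norm_pow]
      exact hD _ n
    · rw [norm_zero]; positivity

end Coefficients

/-! ### The integrated current on a finite lattice -/

section FiniteLattice

lemma transition_eq_zero {S : Set ℤ} [Fintype S] {γ : ℝ} (hγ : 0 ≤ γ) (t : ℝ) {X Y : Finset S}
    (h : X.card ≠ Y.card) : transition S γ t X Y = 0 := by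
  rw [transition, transition_eq_siteTransition hγ]
  exact siteTransition_eq_zero S γ t (by simpa using h)

/-- The number of particles on the sites `x ≥ 1`. -/
def numRight {L : ℕ} (X : Finset (box L)) : ℕ := (X.filter fun x : box L => 0 < (x : ℤ)).card

/-- The probability of a configuration in the step initial state. -/
def initialWeight {L : ℕ} (ρa ρb : ℝ) (X : Finset (box L)) : ℂ :=
  ∏ x : box L, if x ∈ X then (density ρa ρb x : ℂ) else 1 - (density ρa ρb x : ℂ)

lemma probCurrent_eq_sum (L : ℕ) {γ : ℝ} (hγ : 0 ≤ γ) (ρa ρb t : ℝ) (n : ℤ) :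
    probCurrent L γ ρa ρb t n = ∑ X, ∑ Y, if (numRight X : ℤ) - numRight Y = n then
      initialWeight ρa ρb Y * transition (box L) γ t X Y else 0 := by
  have hm : ∀ m : ℕ, (projRight L (m + n) *
      evolve γ t (projRight L m * initialState L ρa ρb * projRight L m)).trace
      = ∑ X, ∑ Y, if m = numRight Y then (if (numRight X : ℤ) - numRight Y = n then
        initialWeight ρa ρb Y * transition (box L) γ t X Y else 0) else 0 := fun m => by
    rw [projRight, projRight, initialState, Matrix.diagonal_mul_diagonal,
      Matrix.diagonal_mul_diagonal, Matrix.trace]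
    refine Finset.sum_congr rfl fun X _ => ?_
    rw [Matrix.diag_apply, Matrix.diagonal_mul, evolve_diagonal_apply hγ, Finset.mul_sum]
    refine Finset.sum_congr rfl fun Y _ => ?_
    change (if (numRight X : ℤ) = m + n then (1 : ℂ) else 0)
      * ((if (numRight Y : ℤ) = m then (1 : ℂ) else 0) * initialWeight ρa ρb Y
        * (if (numRight Y : ℤ) = m then (1 : ℂ) else 0) * transition (box L) γ t X Y) = _
    by_cases hY : m = numRight Y
    · subst hY
      have : (numRight X : ℤ) = numRight Y + n ↔ (numRight X : ℤ) - numRight Y = n := by omega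
      simp only [this, if_true]
      split_ifs <;> ring
    · have : ¬((numRight Y : ℤ) = m) := by omega
      simp [hY, this]
  rw [probCurrent]
  simp_rw [hm]
  exact (hasSum_sum fun X _ => hasSum_sum fun Y _ => hasSum_ite_eq (numRight Y) _).tsum_eq

lemma hasSum_mgfCurrent_aux (L : ℕ) {γ : ℝ} (hγ : 0 ≤ γ) (ρa ρb t : ℝ) (z : ℂ) :
    HasSum (fun n : ℤ => Complex.exp (z * n) * probCurrent L γ ρa ρb t n)
      (∑ X, ∑ Y, Complex.exp (z * ((numRight X : ℤ) - numRight Y : ℤ)) *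
        (initialWeight ρa ρb Y * transition (box L) γ t X Y)) := by
  simp_rw [probCurrent_eq_sum L hγ, Finset.mul_sum]
  refine hasSum_sum fun X _ => hasSum_sum fun Y _ => ?_
  have h := hasSum_ite_eq ((numRight X : ℤ) - numRight Y)
    (Complex.exp (z * ((numRight X : ℤ) - numRight Y : ℤ)) *
        (initialWeight ρa ρb Y * transition (box L) γ t X Y))
  refine h.congr_fun fun n => ?_
  split_ifs with h1 h2 h2
  · rw [h1]
  · exact absurd h1.symm h2
  · exact absurd h2.symm h1
  · simp

lemma hasSum_mgfCurrent (L : ℕ) {γ : ℝ} (hγ : 0 ≤ γ) (ρa ρb t : ℝ) (z : ℂ) :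
    HasSum (fun n : ℤ => Complex.exp (z * n) * probCurrent L γ ρa ρb t n)
      (mgfCurrent L γ ρa ρb t z) :=
  (hasSum_mgfCurrent_aux L hγ ρa ρb t z).summable.hasSum

lemma continuous_mgfCurrent (L : ℕ) {γ : ℝ} (hγ : 0 ≤ γ) (ρa ρb t : ℝ) :
    Continuous (mgfCurrent L γ ρa ρb t) := by
  have : mgfCurrent L γ ρa ρb t = fun z => ∑ X, ∑ Y,
      Complex.exp (z * ((numRight X : ℤ) - numRight Y : ℤ)) *
        (initialWeight ρa ρb Y * transition (box L) γ t X Y) :=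
    funext fun z => (hasSum_mgfCurrent_aux L hγ ρa ρb t z).tsum_eq
  rw [this]
  fun_prop

section
open scoped ComplexOrder

lemma probCurrent_nonneg (L : ℕ) {γ ρa ρb t : ℝ} (hγ : 0 ≤ γ) (ht : 0 ≤ t)
    (ha : ρa ∈ Set.Icc (0 : ℝ) 1) (hb : ρb ∈ Set.Icc (0 : ℝ) 1) (n : ℤ) :
    0 ≤ probCurrent L γ ρa ρb t n := by
  rw [probCurrent_eq_sum L hγ]
  refine Finset.sum_nonneg fun X _ => Finset.sum_nonneg fun Y _ => ?_
  split_ifs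
  · refine mul_nonneg (Finset.prod_nonneg fun x _ => ?_) (transition_nonneg hγ ht X Y)
    have hd : density ρa ρb x ∈ Set.Icc (0 : ℝ) 1 := by
      rw [density]; split_ifs <;> assumption
    split_ifs
    · exact_mod_cast hd.1
    · have : (0 : ℝ) ≤ 1 - density ρa ρb x := by linarith [hd.2]
      exact_mod_cast this
  · exact le_rfl

end

/-- The sites `x ≥ 1` of the finite lattice. -/
def rightSites (L : ℕ) : Finset (box L) := Finset.univ.filter fun x : box L => 0 < (x : ℤ)

lemma mem_rightSites {L : ℕ} {x : box L} : x ∈ rightSites L ↔ 0 < (x : ℤ) := by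
  simp [rightSites]

lemma card_le_of_subset_rightSites {L : ℕ} {X : Finset (box L)} (h : X ⊆ rightSites L) :
    X.card ≤ L := by
  rw [← card_sites]
  refine (Finset.card_le_card (t := Finset.Ioc 0 (L : ℤ)) fun x hx => ?_).trans ?_
  · obtain ⟨hS, hx⟩ := mem_sites_iff.1 hx
    exact Finset.mem_Ioc.2 ⟨mem_rightSites.1 (h hx), hS.2⟩
  · simp

lemma q_box_eq_sum (L : ℕ) (γ t : ℝ) (n : ℕ) :
    q (box L) γ t n = ∑ Y ∈ (rightSites L)ᶜ.powerset, ∑ X ∈ (rightSites L).powerset,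
      if Y.card = n ∧ X.card = n then transition (box L) γ t X Y else 0 := by
  classical
  rw [q]
  change ∑' p : ({p : Finset (box L) × Finset (box L) | p.1.card = n ∧ p.2.card = n ∧
    (∀ y ∈ p.1, (y : ℤ) ≤ 0) ∧ (∀ x ∈ p.2, 0 < (x : ℤ))} : Set _),
      transition (box L) γ t p.1.2 p.1.1 = _
  rw [tsum_subtype _ fun p : Finset (box L) × Finset (box L) =>
    transition (box L) γ t p.2 p.1, tsum_fintype, Fintype.sum_prod_type]
  have hsub : ∀ p : Finset (box L) × Finset (box L),
      ((∀ y ∈ p.1, (y : ℤ) ≤ 0) ∧ (∀ x ∈ p.2, 0 < (x : ℤ)))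
        ↔ (p.1 ∈ (rightSites L)ᶜ.powerset ∧ p.2 ∈ (rightSites L).powerset) := fun p => by
    simp only [Finset.mem_powerset, Finset.subset_iff, Finset.mem_compl, mem_rightSites, not_lt]
  rw [← Finset.sum_subset (Finset.subset_univ (rightSites L)ᶜ.powerset)]
  · refine Finset.sum_congr rfl fun Y hY => ?_
    rw [← Finset.sum_subset (Finset.subset_univ (rightSites L).powerset)]
    · refine Finset.sum_congr rfl fun X hX => ?_
      have := (hsub (Y, X)).2 ⟨hY, hX⟩
      rw [Set.indicator_apply]
      refine if_congr ?_ rfl rfl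
      simp only [Set.mem_ofPred_eq]
      tauto
    · intro X _ hX
      exact Set.indicator_of_notMem (fun h => hX ((hsub (Y, X)).1 h.2.2).2) _
  · intro Y _ hY
    exact Finset.sum_eq_zero fun X _ =>
      Set.indicator_of_notMem (fun h => hY ((hsub (Y, X)).1 h.2.2).1) _

/-- The generating function of the integrated current on a finite lattice. -/
lemma mgfCurrent_eq_sum_q (L : ℕ) {γ : ℝ} (hγ : 0 ≤ γ) (ρa ρb t : ℝ) (z : ℂ) :
    mgfCurrent L γ ρa ρb t z
      = ∑ n ∈ Finset.range (L + 1), q (box L) γ t n * omega ρa ρb z ^ n := by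
  have hN : ∀ X Y : Finset (box L), X.card ≠ Y.card → transition (box L) γ t X Y = 0 :=
    fun X Y h => transition_eq_zero hγ t h
  have hT1 := sum_superset_eq_sum_powerset hN (sum_transition_insert hγ t)
  have hT2 := sum_superset_eq_sum_powerset (T := fun X Y => transition (box L) γ t Y X)
    (fun X Y h => hN Y X h.symm) (fun X Y => sum_transition_erase hγ t Y X)
  have huv : Complex.exp z * Complex.exp (-z) = 1 := by
    rw [← Complex.exp_add, add_neg_cancel, Complex.exp_zero]
  have key := sum_prod_eq hN hT1 (fun X Y => hT2 Y X) (rightSites L) huv (ρa : ℂ) (ρb : ℂ)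
  have hpow : ∀ (c : ℂ) (X : Finset (box L)),
      (∏ x ∈ X, if x ∈ rightSites L then c else 1) = c ^ numRight X := fun c X => by
    simp_rw [mem_rightSites]
    rw [Finset.prod_ite, Finset.prod_const, Finset.prod_const_one, mul_one, numRight]
  have hP : ∀ Y : Finset (box L),
      ((∏ y ∈ Y, if y ∈ rightSites L then (ρb : ℂ) * Complex.exp (-z) else ρa)
        * ∏ y ∈ Yᶜ, if y ∈ rightSites L then 1 - (ρb : ℂ) else 1 - ρa)
      = initialWeight ρa ρb Y * Complex.exp (-z) ^ numRight Y := fun Y => by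
    rw [initialWeight, ← Finset.prod_mul_prod_compl Y, ← hpow, mul_right_comm,
      ← Finset.prod_mul_distrib]
    congr 1
    · refine Finset.prod_congr rfl fun y hy => ?_
      simp only [mem_rightSites, hy, if_true, density]
      by_cases h : 0 < (y : ℤ)
      · rw [if_pos h, if_pos h, if_neg (not_le.2 h)]
      · rw [if_neg h, if_neg h, if_pos (not_lt.1 h), mul_one]
    · refine Finset.prod_congr rfl fun y hy => ?_
      rw [Finset.mem_compl] at hy
      simp only [mem_rightSites, hy, if_false, density]
      by_cases h : 0 < (y : ℤ)
      · rw [if_pos h, if_neg (not_le.2 h)]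
      · rw [if_neg h, if_pos (not_lt.1 h)]
  rw [mgfCurrent, (hasSum_mgfCurrent_aux L hγ ρa ρb t z).tsum_eq]
  trans ∑ Y, (initialWeight ρa ρb Y * Complex.exp (-z) ^ numRight Y)
    * ∑ X, Complex.exp z ^ numRight X * transition (box L) γ t X Y
  · rw [Finset.sum_comm]
    refine Finset.sum_congr rfl fun Y _ => ?_
    rw [Finset.mul_sum]
    refine Finset.sum_congr rfl fun X _ => ?_
    have : Complex.exp (z * ((numRight X : ℤ) - numRight Y : ℤ))
        = Complex.exp z ^ numRight X * Complex.exp (-z) ^ numRight Y := by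
      rw [← Complex.exp_nat_mul, ← Complex.exp_nat_mul, ← Complex.exp_add]
      congr 1
      push_cast
      ring
    rw [this]
    ring
  · simp_rw [hP, hpow] at key
    rw [key]
    change ∑ Y ∈ (rightSites L)ᶜ.powerset, ∑ X ∈ (rightSites L).powerset,
      omega ρa ρb z ^ X.card * transition (box L) γ t X Y = _
    simp_rw [q_box_eq_sum, Finset.sum_mul]
    symm
    rw [Finset.sum_comm]
    refine Finset.sum_congr rfl fun Y _ => ?_
    rw [Finset.sum_comm]
    refine Finset.sum_congr rfl fun X hX => ?_
    rw [Finset.sum_eq_single X.card]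
    · by_cases h : Y.card = X.card
      · rw [if_pos ⟨h, rfl⟩, mul_comm]
      · rw [if_neg (fun hc => h hc.1), hN X Y (Ne.symm h)]
        ring
    · intro n _ hn
      rw [if_neg (fun hc => hn hc.2.symm), zero_mul]
    · intro hn
      have := card_le_of_subset_rightSites (Finset.mem_powerset.1 hX)
      exact absurd (Finset.mem_range.2 (by omega)) hn

end FiniteLattice

/-! ### Limits of laws on the integers -/

section LimitLaw
open MeasureTheory Filter Topology

lemma integral_exp_int_mul_I (m : ℤ) :
    ∫ θ in (0 : ℝ)..2 * Real.pi, Complex.exp (m * Complex.I * θ)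
      = if m = 0 then 2 * (Real.pi : ℂ) else 0 := by
  split_ifs with h
  · subst h
    simp
  · have hm : (m : ℂ) * Complex.I ≠ 0 := mul_ne_zero (by exact_mod_cast h) Complex.I_ne_zero
    rw [integral_exp_mul_complex hm]
    have : Complex.exp (m * Complex.I * ((2 * Real.pi : ℝ) : ℂ)) = 1 := by
      rw [← Complex.exp_int_mul_two_pi_mul_I m]
      congr 1
      push_cast
      ring
    rw [this]
    simp

/-- Fourier inversion for a summable weight on the integers. -/
lemma integral_exp_mul_tsum {p : ℤ → ℝ} (hp0 : ∀ n, 0 ≤ p n) (hp : Summable p) {φ : ℂ → ℂ}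
    (hφ : ∀ z : ℂ, HasSum (fun n : ℤ => Complex.exp (z * n) * p n) (φ z)) (n : ℤ) :
    ∫ θ in (0 : ℝ)..2 * Real.pi, Complex.exp ((-n : ℤ) * Complex.I * θ) * φ (Complex.I * θ)
      = 2 * Real.pi * p n := by
  set F : ℤ → ℝ → ℂ := fun m θ => Complex.exp ((m - n : ℤ) * Complex.I * θ) * p m with hF
  have hsum := intervalIntegral.hasSum_integral_of_dominated_convergence
    (a := 0) (b := 2 * Real.pi) (μ := volume) (F := F)
    (f := fun θ : ℝ => Complex.exp ((-n : ℤ) * Complex.I * θ) * φ (Complex.I * θ))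
    (fun m _ => p m)
    (fun m => by
      refine Continuous.aestronglyMeasurable ?_
      simp only [hF]
      fun_prop)
    (fun m => Eventually.of_forall fun θ _ => by
      have : ((m - n : ℤ) : ℂ) * Complex.I * θ = (((m - n : ℤ) : ℝ) * θ : ℝ) * Complex.I := by
        push_cast; ring
      rw [hF]
      simp only
      rw [norm_mul, this, Complex.norm_exp_ofReal_mul_I, one_mul, Complex.norm_real,
        Real.norm_of_nonneg (hp0 m)])
    (Eventually.of_forall fun θ _ => hp)
    (by simp)
    (Eventually.of_forall fun θ _ => by
      refine ((hφ (Complex.I * θ)).mul_left _).congr_fun fun m => ?_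
      rw [hF]
      simp only
      rw [← mul_assoc, ← Complex.exp_add]
      congr 2
      push_cast
      ring)
  rw [← hsum.tsum_eq, tsum_eq_single n]
  · simp only [hF, sub_self, intervalIntegral.integral_mul_const, integral_exp_int_mul_I, if_true]
  · intro m hm
    simp only [hF, intervalIntegral.integral_mul_const, integral_exp_int_mul_I,
      if_neg (sub_ne_zero.2 hm), zero_mul]

lemma summable_exp_mul_abs {c : ℝ} (hc : c < 0) :
    Summable fun n : ℤ => Real.exp (c * |(n : ℝ)|) := by
  have h : Summable fun n : ℕ => Real.exp (c * n) := by
    have := summable_geometric_of_lt_one (Real.exp_pos c).le (Real.exp_lt_one_iff.2 hc)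
    refine this.congr fun n => ?_
    rw [← Real.exp_nat_mul, mul_comm]
  refine Summable.of_nat_of_neg ?_ ?_
  · simpa using h
  · simpa using h

lemma integrable_of_summable {μ : Measure ℤ} {f : ℤ → ℂ}
    (h : Summable fun n : ℤ => ‖f n‖ * μ.real {n}) [IsFiniteMeasure μ] : Integrable f μ := by
  refine ⟨(Measurable.of_discrete).aestronglyMeasurable, ?_⟩
  rw [HasFiniteIntegral, lintegral_countable']
  have : ∀ n : ℤ, ‖f n‖ₑ * μ {n} = ENNReal.ofReal (‖f n‖ * μ.real {n}) := fun n => by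
    rw [ENNReal.ofReal_mul (norm_nonneg _), ofReal_norm, Measure.real,
      ENNReal.ofReal_toReal (measure_ne_top μ _)]
  simp_rw [this]
  rw [← ENNReal.ofReal_tsum_of_nonneg (fun n => by positivity) h]
  exact ENNReal.ofReal_lt_top

/-- If the moment generating functions of laws on the integers converge pointwise on `ℂ`, then the
laws converge to a law that has the limit as its moment generating function. The weights converge
by Fourier inversion, and the convergence at `±K` gives exponential tails. -/
lemma exists_limit_law {p : ℕ → ℤ → ℝ} (hp0 : ∀ L n, 0 ≤ p L n) {φ : ℕ → ℂ → ℂ}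
    (hcont : ∀ L, Continuous (φ L))
    (hφ : ∀ L (z : ℂ), HasSum (fun n : ℤ => Complex.exp (z * n) * p L n) (φ L z))
    (h1 : ∀ L, φ L 0 = 1) {G : ℂ → ℂ} (hG : ∀ z, Tendsto (fun L => φ L z) atTop (𝓝 (G z))) :
    ∃ μ : Measure ℤ, IsProbabilityMeasure μ ∧
      (∀ n, Tendsto (fun L => p L n) atTop (𝓝 (μ.real {n}))) ∧
      ∀ z : ℂ, Integrable (fun n : ℤ => Complex.exp (z * n)) μ ∧
        ∫ n : ℤ, Complex.exp (z * n) ∂μ = G z := by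
  have hone : ∀ L, HasSum (p L) 1 := fun L => by
    have := hφ L 0
    rw [h1] at this
    simp only [zero_mul, Complex.exp_zero, one_mul] at this
    exact Complex.hasSum_ofReal.1 (by simpa using this)
  have hnorm : ∀ (z : ℂ) (n : ℤ), ‖Complex.exp (z * n)‖ = Real.exp (z.re * n) := fun z n => by
    rw [Complex.norm_exp]; simp
  -- existence of the limits of the weights
  have hlim : ∀ n : ℤ, ∃ c : ℝ, Tendsto (fun L => p L n) atTop (𝓝 c) := fun n => by
    have hb : ∀ (L : ℕ) (θ : ℝ), ‖φ L (Complex.I * θ)‖ ≤ 1 := fun L θ => by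
      rw [← (hφ L (Complex.I * θ)).tsum_eq]
      refine tsum_of_norm_bounded (hone L) fun m => ?_
      rw [norm_mul, hnorm, Complex.norm_real, Real.norm_of_nonneg (hp0 L m)]
      simp
    have hint := intervalIntegral.tendsto_integral_filter_of_dominated_convergence
      (a := 0) (b := 2 * Real.pi) (μ := volume) (l := atTop)
      (F := fun (L : ℕ) (θ : ℝ) =>
        Complex.exp ((-n : ℤ) * Complex.I * θ) * φ L (Complex.I * θ))
      (f := fun θ : ℝ => Complex.exp ((-n : ℤ) * Complex.I * θ) * G (Complex.I * θ))
      (fun _ => 1)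
      (Eventually.of_forall fun L => by
        refine Continuous.aestronglyMeasurable ?_
        have := hcont L
        fun_prop)
      (Eventually.of_forall fun L => Eventually.of_forall fun θ _ => by
        have : ((-n : ℤ) : ℂ) * Complex.I * θ = (((-n : ℤ) : ℝ) * θ : ℝ) * Complex.I := by
          push_cast; ring
        rw [norm_mul, this, Complex.norm_exp_ofReal_mul_I, one_mul]
        exact hb L θ)
      (by simp)
      (Eventually.of_forall fun θ _ => (hG _).const_mul _)
    simp_rw [fun L => integral_exp_mul_tsum (hp0 L) (hone L).summable (hφ L) n] at hint
    have h2 := (Complex.continuous_re.tendsto _).comp (hint.const_mul (2 * (Real.pi : ℂ))⁻¹)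
    refine ⟨_, h2.congr fun L => ?_⟩
    have hpi : (2 * (Real.pi : ℂ)) ≠ 0 := by
      have := Real.pi_ne_zero
      exact_mod_cast mul_ne_zero two_ne_zero this
    rw [Function.comp_apply, ← mul_assoc, inv_mul_cancel₀ hpi, one_mul, Complex.ofReal_re]
  choose r hr using hlim
  have hr0 : ∀ n, 0 ≤ r n := fun n => ge_of_tendsto' (hr n) fun L => hp0 L n
  -- exponential tails, uniformly in `L`
  have htail : ∀ K : ℝ, 0 ≤ K → ∃ B : ℝ, ∀ (L : ℕ) (n : ℤ),
      p L n ≤ B * Real.exp (-K * |(n : ℝ)|) := by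
    intro K hK
    have hbd : ∀ k : ℝ, ∃ B : ℝ, ∀ L, ‖φ L k‖ ≤ B := fun k => by
      obtain ⟨B, hB⟩ := (hG k).norm.bddAbove_range
      exact ⟨B, fun L => hB ⟨L, rfl⟩⟩
    obtain ⟨B1, hB1⟩ := hbd K
    obtain ⟨B2, hB2⟩ := hbd (-K : ℝ)
    have hle : ∀ (k : ℝ) (L : ℕ) (n : ℤ), Real.exp (k * n) * p L n ≤ ‖φ L k‖ := fun k L n => by
      have h2 : HasSum (fun n : ℤ => Real.exp (k * n) * p L n) (φ L k).re := by
        refine (Complex.hasSum_re (hφ L k)).congr_fun fun n => ?_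
        rw [← Complex.ofReal_re (Real.exp (k * n) * p L n)]
        congr 1
        push_cast
        rfl
      refine (le_hasSum h2 n fun m _ => mul_nonneg (Real.exp_pos _).le (hp0 L m)).trans ?_
      exact Complex.re_le_norm _
    refine ⟨max B1 B2, fun L n => ?_⟩
    have h3 : Real.exp (K * |(n : ℝ)|) * p L n ≤ max B1 B2 := by
      rcases abs_cases (n : ℝ) with ⟨h, -⟩ | ⟨h, -⟩
      · rw [h]
        exact (hle K L n).trans ((hB1 L).trans (le_max_left _ _))
      · rw [h, mul_neg, ← neg_mul]
        exact (hle (-K) L n).trans ((hB2 L).trans (le_max_right _ _))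
    rw [neg_mul, Real.exp_neg, ← div_eq_mul_inv, le_div_iff₀ (Real.exp_pos _), mul_comm]
    exact h3
  -- convergence of the moment generating functions
  have hmgf : ∀ z : ℂ, (Summable fun n : ℤ => ‖Complex.exp (z * n)‖ * r n) ∧
      HasSum (fun n : ℤ => Complex.exp (z * n) * r n) (G z) := fun z => by
    obtain ⟨B, hB⟩ := htail (|z.re| + 1) (by positivity)
    have hbound : ∀ (n : ℤ) (x : ℝ), x ≤ B * Real.exp (-(|z.re| + 1) * |(n : ℝ)|) →
        ‖Complex.exp (z * n)‖ * x ≤ B * Real.exp (-1 * |(n : ℝ)|) := fun n x hx => by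
      rw [hnorm]
      have hB0 : 0 ≤ B := by
        have := (hp0 0 0).trans (hB 0 0)
        simpa using this
      have h4 : z.re * n ≤ |z.re| * |(n : ℝ)| := (le_abs_self _).trans (abs_mul _ _).le
      calc Real.exp (z.re * n) * x
          ≤ Real.exp (|z.re| * |(n : ℝ)|) * (B * Real.exp (-(|z.re| + 1) * |(n : ℝ)|)) :=
            (mul_le_mul_of_nonneg_left hx (Real.exp_pos _).le).trans
              (mul_le_mul_of_nonneg_right (Real.exp_le_exp.2 h4) (by positivity))
        _ = B * Real.exp (-1 * |(n : ℝ)|) := by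
            rw [mul_left_comm, ← Real.exp_add]
            congr 2
            ring
    have hs := (summable_exp_mul_abs (c := -1) (by norm_num)).mul_left B
    have hrB : ∀ n : ℤ, r n ≤ B * Real.exp (-(|z.re| + 1) * |(n : ℝ)|) := fun n =>
      le_of_tendsto' (hr n) fun L => hB L n
    have hsr : Summable fun n : ℤ => ‖Complex.exp (z * n)‖ * r n :=
      Summable.of_nonneg_of_le (fun n => mul_nonneg (norm_nonneg _) (hr0 n))
        (fun n => hbound n _ (hrB n)) hs
    refine ⟨hsr, ?_⟩
    have hsc : Summable fun n : ℤ => Complex.exp (z * n) * r n :=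
      Summable.of_norm_bounded hsr fun n => by
        rw [norm_mul, Complex.norm_real, Real.norm_of_nonneg (hr0 n)]
    have ht : Tendsto (fun L => ∑' n : ℤ, Complex.exp (z * n) * p L n) atTop
        (𝓝 (∑' n : ℤ, Complex.exp (z * n) * r n)) := by
      refine tendsto_tsum_of_dominated_convergence hs (fun n => ?_)
        (Eventually.of_forall fun L n => ?_)
      · exact ((Complex.continuous_ofReal.tendsto _).comp (hr n)).const_mul _
      · rw [norm_mul, Complex.norm_real, Real.norm_of_nonneg (hp0 L n)]
        exact hbound n _ (hB L n)
    have : G z = ∑' n : ℤ, Complex.exp (z * n) * r n :=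
      tendsto_nhds_unique (hG z) (ht.congr fun L => (hφ L z).tsum_eq)
    rw [this]
    exact hsc.hasSum
  have hr1 : HasSum r 1 := by
    have h := (hmgf 0).2
    rw [tendsto_nhds_unique (hG 0) (by simp_rw [h1]; exact tendsto_const_nhds)] at h
    simp only [zero_mul, Complex.exp_zero, one_mul] at h
    exact Complex.hasSum_ofReal.1 (by simpa using h)
  set P : PMF ℤ := ⟨fun n => ENNReal.ofReal (r n), by
    rw [ENNReal.summable.hasSum_iff, ← ENNReal.ofReal_tsum_of_nonneg hr0 hr1.summable,
      hr1.tsum_eq, ENNReal.ofReal_one]⟩ with hP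
  have hreal : ∀ n, P.toMeasure.real {n} = r n := fun n => by
    rw [Measure.real, PMF.toMeasure_apply_singleton _ _ (measurableSet_singleton n)]
    exact ENNReal.toReal_ofReal (hr0 n)
  refine ⟨P.toMeasure, inferInstance, fun n => ?_, fun z => ?_⟩
  · rw [hreal]
    exact hr n
  · have hi : Integrable (fun n : ℤ => Complex.exp (z * n)) P.toMeasure := by
      refine integrable_of_summable ?_
      simp_rw [hreal]
      exact (hmgf z).1
    refine ⟨hi, ?_⟩
    rw [integral_countable hi, ← (hmgf z).2.tsum_eq]
    refine tsum_congr fun n => ?_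
    rw [hreal, Complex.real_smul, mul_comm]

end LimitLaw

/-! ### The variance -/

section Variance
open MeasureTheory ProbabilityTheory

/-- A power series with coefficients of superexponential decay is an entire function. -/
lemma differentiable_tsum_mul_pow {c : ℕ → ℂ}
    (hc : ∀ M : ℝ, 0 ≤ M → Summable fun n => ‖c n‖ * M ^ n) :
    Differentiable ℂ fun w : ℂ => ∑' n, c n * w ^ n := by
  intro w
  have h := Complex.differentiableOn_tsum_of_summable_norm (U := Metric.ball (0 : ℂ) (‖w‖ + 1))
    (F := fun n w => c n * w ^ n) (hc (‖w‖ + 1) (by positivity))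
    (fun n => by fun_prop) Metric.isOpen_ball fun n x hx => by
      rw [norm_mul, norm_pow]
      have : ‖x‖ ≤ ‖w‖ + 1 := (mem_ball_zero_iff.1 hx).le
      gcongr
  exact h.differentiableAt (Metric.isOpen_ball.mem_nhds (by simp))

/-- The first two derivatives at a zero of `f` of a power series composed with `f`. -/
lemma derivs_tsum_mul_pow_comp {c : ℕ → ℂ}
    (hc : ∀ M : ℝ, 0 ≤ M → Summable fun n => ‖c n‖ * M ^ n) {f f' : ℂ → ℂ} {f'' : ℂ}
    (hf : ∀ z, HasDerivAt f (f' z) z) (hf' : HasDerivAt f' f'' 0) (h0 : f 0 = 0) :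
    deriv (fun z => ∑' n, c n * f z ^ n) 0 = c 1 * f' 0 ∧
      deriv (deriv fun z => ∑' n, c n * f z ^ n) 0 = c 1 * f'' + 2 * c 2 * f' 0 ^ 2 := by
  have hc3 : ∀ M : ℝ, 0 ≤ M → Summable fun n => ‖c (n + 3)‖ * M ^ n := fun M hM => by
    refine Summable.of_nonneg_of_le (fun n => by positivity) (fun n => ?_)
      ((summable_nat_add_iff 3).2 (hc (max M 1) (by positivity)))
    gcongr
    exact (pow_le_pow_left₀ hM (le_max_left M 1) n).trans
      (pow_le_pow_right₀ (le_max_right M 1) (by omega))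
  -- only the first three coefficients matter; `w ^ 3 * R w` is the rest of the series
  set R : ℂ → ℂ := fun w => ∑' n, c (n + 3) * w ^ n with hR
  have hRd : Differentiable ℂ R := differentiable_tsum_mul_pow hc3
  have hRd' : Differentiable ℂ (deriv R) := by
    have := (hRd.differentiableOn (s := Set.univ)).deriv isOpen_univ
    exact differentiableOn_univ.1 this
  have hsplit : ∀ w : ℂ, ∑' n, c n * w ^ n = c 0 + c 1 * w + c 2 * w ^ 2 + w ^ 3 * R w :=
    fun w => by
      have hs : Summable fun n => c n * w ^ n :=
        Summable.of_norm (by simpa [norm_mul, norm_pow] using hc ‖w‖ (norm_nonneg w))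
      rw [← hs.sum_add_tsum_nat_add 3, hR, ← tsum_mul_left]
      simp only [Finset.sum_range_succ, Finset.sum_range_zero, zero_add, pow_zero, mul_one, pow_one]
      congr 1
      exact tsum_congr fun n => by ring
  simp_rw [hsplit]
  have hd1 : ∀ z, HasDerivAt (fun z => c 0 + c 1 * f z + c 2 * f z ^ 2 + f z ^ 3 * R (f z))
      (f' z * (c 1 + 2 * c 2 * f z + f z ^ 2 * (3 * R (f z) + f z * deriv R (f z)))) z :=
    fun z => by
      have hRz : HasDerivAt (fun z => R (f z)) (deriv R (f z) * f' z) z :=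
        (hRd (f z)).hasDerivAt.comp z (hf z)
      have := ((((hf z).const_mul (c 1)).const_add (c 0)).add
        (((hf z).pow 2).const_mul (c 2))).add (((hf z).pow 3).mul hRz)
      refine this.congr_deriv ?_
      simp only [Pi.pow_apply, Nat.cast_ofNat]
      ring
  have hderiv : deriv (fun z => c 0 + c 1 * f z + c 2 * f z ^ 2 + f z ^ 3 * R (f z))
      = fun z => f' z * (c 1 + 2 * c 2 * f z + f z ^ 2 * (3 * R (f z) + f z * deriv R (f z))) :=
    funext fun z => (hd1 z).deriv
  refine ⟨?_, ?_⟩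
  · rw [(hd1 0).deriv, h0]
    ring
  · rw [hderiv]
    have hK : DifferentiableAt ℂ (fun z => 3 * R (f z) + f z * deriv R (f z)) 0 := by
      have hf0 : DifferentiableAt ℂ f 0 := (hf 0).differentiableAt
      have h1 : DifferentiableAt ℂ (fun z => R (f z)) 0 := (hRd (f 0)).comp 0 hf0
      have h2 : DifferentiableAt ℂ (fun z => deriv R (f z)) 0 := (hRd' (f 0)).comp 0 hf0
      exact (h1.const_mul 3).add (hf0.mul h2)
    have := hf'.mul ((((hf 0).const_mul (2 * c 2)).const_add (c 1)).add
      (((hf 0).pow 2).mul hK.hasDerivAt))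
    refine (this.congr_deriv ?_).deriv
    simp only [Pi.pow_apply, Nat.cast_ofNat, Pi.add_apply, Pi.mul_apply, h0]
    ring

lemma omega_zero (ρa ρb : ℝ) : omega ρa ρb 0 = 0 := by simp [omega]

/-- The derivative of `omega`. -/
def omegaDeriv (ρa ρb : ℝ) (z : ℂ) : ℂ :=
  ρa * (1 - ρb) * Complex.exp z - ρb * (1 - ρa) * Complex.exp (-z)

lemma hasDerivAt_exp_neg (z : ℂ) :
    HasDerivAt (fun z => Complex.exp (-z)) (-Complex.exp (-z)) z := by
  simpa using (hasDerivAt_neg z).cexp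

lemma hasDerivAt_omega (ρa ρb : ℝ) (z : ℂ) :
    HasDerivAt (omega ρa ρb) (omegaDeriv ρa ρb z) z := by
  have h1 := (Complex.hasDerivAt_exp z).sub_const 1
  have h2 := (hasDerivAt_exp_neg z).sub_const 1
  have h := ((h1.const_mul (ρa : ℂ)).add (h2.const_mul (ρb : ℂ))).add
    ((h1.const_mul (ρa * ρb : ℂ)).mul h2)
  refine h.congr_deriv ?_
  have he : Complex.exp z * Complex.exp (-z) = 1 := by
    rw [← Complex.exp_add, add_neg_cancel, Complex.exp_zero]
  rw [omegaDeriv]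
  ring

lemma hasDerivAt_omegaDeriv_zero (ρa ρb : ℝ) :
    HasDerivAt (omegaDeriv ρa ρb) (ρa + ρb - 2 * ρa * ρb) 0 := by
  have h := ((Complex.hasDerivAt_exp 0).const_mul (ρa * (1 - ρb) : ℂ)).sub
    ((hasDerivAt_exp_neg 0).const_mul (ρb * (1 - ρa) : ℂ))
  refine h.congr_deriv ?_
  simp only [neg_zero, Complex.exp_zero]
  ring

/-- The variance of a law on the integers whose moment generating function is a power series in
`ω`. -/
lemma variance_of_integral_exp_eq {μ : Measure ℤ} [IsProbabilityMeasure μ] {c : ℕ → ℂ}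
    (hc : ∀ M : ℝ, 0 ≤ M → Summable fun n => ‖c n‖ * M ^ n) {ρa ρb : ℝ}
    (hint : ∀ z : ℂ, Integrable (fun n : ℤ => Complex.exp (z * n)) μ)
    (h : ∀ z : ℂ, ∫ n : ℤ, Complex.exp (z * n) ∂μ = ∑' n, c n * omega ρa ρb z ^ n) :
    MemLp (fun n : ℤ => (n : ℝ)) 2 μ ∧
      ((variance (fun n : ℤ => (n : ℝ)) μ : ℝ) : ℂ)
        = ((ρa : ℂ) - ρb) ^ 2 * (2 * c 2 - c 1 ^ 2)
          + ((ρa : ℂ) + ρb - 2 * ρa * ρb) * c 1 := by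
  set X : ℤ → ℝ := fun n => (n : ℝ) with hX
  have hset : integrableExpSet X μ = Set.univ := by
    ext s
    simp only [Set.mem_univ, iff_true]
    refine (hint s).norm.congr (Filter.Eventually.of_forall fun n => ?_)
    change ‖Complex.exp ((s : ℂ) * (n : ℂ))‖ = Real.exp (s * X n)
    rw [Complex.norm_exp]
    simp [hX]
  have hmem : MemLp X 2 μ :=
    memLp_of_mem_interior_integrableExpSet (by rw [hset, interior_univ]; trivial) 2
  refine ⟨hmem, ?_⟩
  have hmgf : complexMGF X μ = fun z => ∑' n, c n * omega ρa ρb z ^ n := by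
    funext z
    rw [← h z, complexMGF]
    simp [hX]
  have hmom : ∀ k, iteratedDeriv k (complexMGF X μ) 0 = ((∫ n, X n ^ k ∂μ : ℝ) : ℂ) := fun k => by
    rw [iteratedDeriv_complexMGF (by rw [hset, interior_univ]; trivial), ← integral_complex_ofReal]
    simp
  have hd := derivs_tsum_mul_pow_comp hc (hasDerivAt_omega ρa ρb)
    (hasDerivAt_omegaDeriv_zero ρa ρb) (omega_zero ρa ρb)
  have hm1 := hmom 1
  have hm2 := hmom 2
  rw [iteratedDeriv_one, hmgf, hd.1] at hm1
  rw [iteratedDeriv_succ, iteratedDeriv_one, hmgf, hd.2] at hm2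
  rw [variance_eq_sub hmem]
  simp only [pow_one] at hm1
  have hsq : ∫ n, (X ^ 2) n ∂μ = ∫ n, X n ^ 2 ∂μ := rfl
  rw [hsq, Complex.ofReal_sub, Complex.ofReal_pow, ← hm1, ← hm2, omegaDeriv]
  simp only [neg_zero, Complex.exp_zero]
  ring

end Variance

/-! ### The limit law of the infinite chain -/

section InfiniteChain
open MeasureTheory

/-- The empty configuration does not evolve. -/
lemma q_zero (S : Set ℤ) {γ t : ℝ} (hγ : 0 ≤ γ) (ht : 0 ≤ t) : q S γ t 0 = 1 := by
  have hmem : ((∅, ∅) : Finset ℤ × Finset ℤ) ∈ crossingSet S 0 := by simp [crossingSet]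
  rw [q_eq_tsum hγ, tsum_eq_single (∅, ∅), siteCrossingTerm, Set.indicator_of_mem hmem,
    siteTransition, tsum_eq_single 0]
  · simp [siteTerm, siteKetBra]
  · intro k hk
    have := norm_siteTerm_le S hγ ht ∅ ∅ ∅ k
    rw [Finset.card_empty, Nat.cast_zero, mul_zero, mul_zero, zero_pow hk, zero_div,
      zero_mul] at this
    exact norm_le_zero_iff.1 this
  · rintro ⟨A, X⟩ hne
    refine Set.indicator_of_notMem (fun h => hne ?_) _
    obtain ⟨⟨h1, h2, -⟩, -⟩ := h
    rw [Finset.card_eq_zero] at h1 h2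
    simp only at h1 h2
    rw [h1, h2]

lemma summable_norm_q_mul_pow (S : Set ℤ) {γ t : ℝ} (hγ : 0 ≤ γ) (ht : 0 ≤ t) (M : ℝ)
    (hM : 0 ≤ M) : Summable fun n => ‖q S γ t n‖ * M ^ n := by
  obtain ⟨D, -, hD⟩ := exists_norm_q_le hγ ht hM
  exact Summable.of_nonneg_of_le (fun n => by positivity) (hD S)
    ((summable_geometric_of_lt_one (by norm_num : (0 : ℝ) ≤ 1 / 2) (by norm_num)).mul_left D)

open scoped ComplexOrder in
/-- The limit law of the integrated current, with its moment generating function. -/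
lemma exists_currentLaw {γ t ρa ρb : ℝ} (hγ : 0 ≤ γ) (ht : 0 ≤ t)
    (ha : ρa ∈ Set.Icc (0 : ℝ) 1) (hb : ρb ∈ Set.Icc (0 : ℝ) 1) :
    ∃ μ : Measure ℤ, IsCurrentLaw γ ρa ρb t μ ∧
      ∀ z : ℂ, Integrable (fun n : ℤ => Complex.exp (z * n)) μ ∧
        ∫ n : ℤ, Complex.exp (z * n) ∂μ = ∑' n, q Set.univ γ t n * omega ρa ρb z ^ n := by
  have hre : ∀ L n, ((probCurrent L γ ρa ρb t n).re : ℂ) = probCurrent L γ ρa ρb t n :=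
    fun L n => (Complex.eq_re_of_ofReal_le (probCurrent_nonneg L hγ ht ha hb n)).symm
  obtain ⟨μ, h1, h2, h3⟩ := exists_limit_law
    (p := fun L n => (probCurrent L γ ρa ρb t n).re)
    (φ := fun L => mgfCurrent L γ ρa ρb t)
    (G := fun z => ∑' n, q Set.univ γ t n * omega ρa ρb z ^ n)
    (fun L n => (Complex.le_def.1 (probCurrent_nonneg L hγ ht ha hb n)).1)
    (fun L => continuous_mgfCurrent L hγ ρa ρb t)
    (fun L z => by
      simp only [hre]
      exact hasSum_mgfCurrent L hγ ρa ρb t z)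
    (fun L => by
      rw [mgfCurrent_eq_sum_q L hγ, omega_zero, Finset.sum_eq_single 0]
      · simp [q_zero _ hγ ht]
      · intro n _ hn
        rw [zero_pow hn, mul_zero]
      · simp)
    (fun z => by
      simp only [mgfCurrent_eq_sum_q _ hγ]
      exact tendsto_sum_q_mul_pow hγ ht _)
  refine ⟨μ, ⟨h1, fun n => ?_⟩, h3⟩
  have := (Complex.continuous_ofReal.tendsto _).comp (h2 n)
  exact this.congr fun L => hre L n

end InfiniteChain

end
end DephasingChain

theorem mainTheorem1 (γ t : ℝ) (hγ : 0 ≤ γ) (ht : 0 ≤ t) :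
    -- the coefficients of the infinite chain are given by convergent series
    (∀ X Y Z : Finset (Set.univ : Set ℤ),
      Summable (DephasingChain.evolveTerm γ t (DephasingChain.ketBra Y) X Z)) ∧
    (∀ n : ℕ, Summable (DephasingChain.crossingTerm Set.univ γ t n)) ∧
    ∀ ρa ∈ Set.Icc (0 : ℝ) 1, ∀ ρb ∈ Set.Icc (0 : ℝ) 1,
      -- finite lattices
      (∀ (L : ℕ) (z : ℂ),
        DephasingChain.mgfCurrent L γ ρa ρb t z
          = ∑ n ∈ Finset.range (L + 1),
              DephasingChain.q (DephasingChain.box L) γ t n * DephasingChain.omega ρa ρb z ^ n) ∧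
      -- the infinite chain
      ∃ μ : MeasureTheory.Measure ℤ, DephasingChain.IsCurrentLaw γ ρa ρb t μ ∧
        (∀ z : ℂ,
          MeasureTheory.Integrable (fun n : ℤ => Complex.exp (z * n)) μ ∧
          Filter.Tendsto (fun L : ℕ => DephasingChain.mgfCurrent L γ ρa ρb t z) Filter.atTop
            (nhds (∫ n : ℤ, Complex.exp (z * n) ∂μ)) ∧
          HasSum (fun n : ℕ =>
              DephasingChain.q Set.univ γ t n * DephasingChain.omega ρa ρb z ^ n)
            (∫ n : ℤ, Complex.exp (z * n) ∂μ)) ∧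
        MeasureTheory.MemLp (fun n : ℤ => (n : ℝ)) 2 μ ∧
        ((ProbabilityTheory.variance (fun n : ℤ => (n : ℝ)) μ : ℝ) : ℂ)
          = ((ρa : ℂ) - ρb) ^ 2
              * (2 * DephasingChain.q Set.univ γ t 2 - DephasingChain.q Set.univ γ t 1 ^ 2)
            + ((ρa : ℂ) + ρb - 2 * ρa * ρb) * DephasingChain.q Set.univ γ t 1 := by
  refine ⟨fun X Y Z => ?_, fun n => DephasingChain.summable_crossingTerm _ hγ ht n,
    fun ρa ha ρb hb => ⟨fun L z => DephasingChain.mgfCurrent_eq_sum_q L hγ ρa ρb t z, ?_⟩⟩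
  · exact (DephasingChain.summable_siteTerm _ hγ ht _ _ _).congr fun k =>
      (DephasingChain.evolveTerm_ketBra hγ t Y X Z k).symm
  · obtain ⟨μ, hμ, hmgf⟩ := DephasingChain.exists_currentLaw hγ ht ha hb
    have := hμ.1
    refine ⟨μ, hμ, fun z => ⟨(hmgf z).1, ?_, ?_⟩,
      DephasingChain.variance_of_integral_exp_eq
        (DephasingChain.summable_norm_q_mul_pow _ hγ ht) (fun z => (hmgf z).1)
        fun z => (hmgf z).2⟩
    · rw [(hmgf z).2]
      simp only [DephasingChain.mgfCurrent_eq_sum_q _ hγ]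
      exact DephasingChain.tendsto_sum_q_mul_pow hγ ht _
    · rw [(hmgf z).2]
      exact (DephasingChain.summable_q_mul_pow _ hγ ht _).hasSum
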